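/- **Setting.** A multi-index (node) of correlation order $\mu\ge 1$ is a multiset ${\bm k}=[k^1,\dots,k^\mu]$ of one-particle indices. The one-particle indices and their degrees are: $k=m\in\mathbb Z$ with degree $|m|$ for $G=\mathbb T$; $k=(n,m)\in\mathbb Z_{\ge 0}\times\mathbb Z$ with degree $n+|m|$ for $G=SO(2)$; $k=(n,l,m)\in\mathbb Z_{\ge 0}\times\mathbb Z_{\ge 0}\times\mathbb Z$ with $|m|\le l$ and degree $n+l$ for $G=O(3)$. The degree $\|{\bm k}\|_1$ is the sum of the degrees of the entries. ${\bm k}$ is *invariant* if $\sum_t m^t=0$ and, for $G=O(3)$, additionally $\sum_t l^t$ is even. Let $\mathcal K_G(\mu,D)$ be the set of invariant ${\bm k}$ of correlation order $\mu$ with $\|{\bm k}\|_1\le D$. **Original insertion heuristic.** Start with the graph whose nodes are all one-particle nodes $[k]$ of degree at most $D\in\mathbb{N}$, and insert all elements of $\bigcup_{\mu=1}^{\nu}\mathcal K_G(\mu,D)$ in increasing correlation order, as follows. To insert ${\bm k}$: if ${\bm k}$ is already a node, do nothing; otherwise, if ${\bm k}$ is the multiset union of two nodes of the graph, add ${\bm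 k}$; otherwise write ${\bm k}=[[k^1],{\bm k}']$ with $k^1$ an entry of maximal degree, recursively insert ${\bm k}'$, and then insert ${\bm k}$. Let $\mathcal A_G(\nu,D)$ be the set of auxiliary nodes of the resulting graph, i.e. the non-invariant nodes of correlation order at least $2$, and let $\mathcal V_G(\nu,D)=\mathcal A_G(\nu,D)\cup\bigcup_{\mu=1}^{\nu}\mathcal K_G(\mu,D)$. **Theorem 2 (Complexity of Algorithm 1).** Let $\nu\ge 3$ be fixed. For $G\in\{\mathbb T,SO(2),O(3)\}$ and every $D\in\mathbb{N}$ the heuristic has an outcome, and $\mathcal V_G(\nu,D)$ is finite in every outcome. For whatever order of insertion within each correlation order, and whatever choice among several entries of maximal degree, the following holds. (i) As $D\to\infty$, $$\frac{\#\mathcal A_{SO(2)}(\nu,D)}{\#\mathcal V_{SO(2)}(\nu,D)}=O\Big(\frac1D\Big),\qquad \frac{\#\mathcal A_{O(3)}(\nu,D)}{\#\mathcal V_{O(3)}(\nu,D)}=O\Big(\frac1{D^2}\Big),$$ with constants depending only on $\nu$. (ii) For every $D\in\mathbb{N}$, $$\#\mathcal A_{\mathbb T}(\nu,D)=2\sum_{k=2}^{\nu-1}\sum_{n=1}^{\lfloor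 D/2\rfloor}\pi(k,n),$$ where $\pi(k,n)$ is the number of integer partitions of $n$ into exactly $k$ parts. Moreover, $$\lim_{D\to\infty}\frac{\#\mathcal A_{\mathbb T}(\nu,D)}{\#\mathcal V_{\mathbb T}(\nu,D)}=\frac1{1+C_{\nu-1}/2},\qquad C_{\nu-1}=\frac1{\nu-1}\binom{2\nu-2}{\nu-2},$$ and $C_{\nu-1}$ is the $(\nu-1)$-th Catalan number. -/

import Mathlib

open Filter Topology

/-- What the insertion heuristic needs to know about the symmetry group: `deg` is the degree of a
one-particle index, `inv` is the set of (nonempty) invariant multi-indices.  A multi-index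
`[k^1, …, k^ν]` is a multiset of one-particle indices, its correlation order is its cardinality.
Only the three concrete instances below are used. -/
structure SymmetryData (κ : Type) where
  deg : κ → ℕ
  inv : Set (Multiset κ)

/-- The torus `𝕋`: one-particle indices `m : ℤ` of degree `|m|`. -/
def torus : SymmetryData ℤ where
  deg m := m.natAbs
  inv := {k | k ≠ 0 ∧ k.sum = 0}

/-- The group `SO(2)`: one-particle indices `(n, m)` with `n ≥ 0`, of degree `n + |m|`. -/
def so2 : SymmetryData (ℕ × ℤ) where
  deg k := k.1 + k.2.natAbs
  inv := {k | k ≠ 0 ∧ (k.map fun a => a.2).sum = 0}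

/-- One-particle indices `(n, l, m)` for `O(3)`: `n, l ≥ 0` and `|m| ≤ l`. -/
structure O3Index where
  n : ℕ
  l : ℕ
  m : ℤ
  abs_m_le : |m| ≤ (l : ℤ)

/-- The group `O(3)`: the index `(n, l, m)` has degree `n + l`. -/
def o3 : SymmetryData O3Index where
  deg k := k.n + k.l
  inv := {k | k ≠ 0 ∧ (k.map fun a => a.m).sum = 0 ∧ Even (k.map fun a => a.l).sum}

namespace SymmetryData

variable {κ : Type}

/-- The total degree `‖k‖₁` of a multi-index. -/
def totalDeg (S : SymmetryData κ) (k : Multiset κ) : ℕ := (k.map S.deg).sum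

/-- `K_G(ν, D)`: the invariant multi-indices of correlation order `ν` and total degree `≤ D`. -/
def basisSet (S : SymmetryData κ) (ν D : ℕ) : Set (Multiset κ) :=
  {k | k ∈ S.inv ∧ S.totalDeg k ≤ D ∧ Multiset.card k = ν}

end SymmetryData

/-- A computational graph: its nodes, and for the nodes `k` that are evaluated as a product
`A_k = A_{k₁} A_{k₂}` the recorded decomposition `(k, k₁, k₂)`. -/
structure CompGraph (κ : Type) where
  nodes : Set (Multiset κ)
  products : Set (Multiset κ × Multiset κ × Multiset κ)

namespace CompGraph

variable {κ : Type}

/-- Add the node `k ≡ [k₁, k₂]`. -/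
def addProduct (𝒢 : CompGraph κ) (k k₁ k₂ : Multiset κ) : CompGraph κ where
  nodes := insert k 𝒢.nodes
  products := insert (k, k₁, k₂) 𝒢.products

/-- `k` has a proper decomposition `[k₁, k₂]` into two nodes of the graph. -/
def Splits (𝒢 : CompGraph κ) (k k₁ k₂ : Multiset κ) : Prop :=
  k₁ ≠ 0 ∧ k₂ ≠ 0 ∧ k = k₁ + k₂ ∧ k₁ ∈ 𝒢.nodes ∧ k₂ ∈ 𝒢.nodes

end CompGraph

/-- `InsertCall S 𝒢 k 𝒢'`: a call of the original recursive procedure `Insert(k)` on the graph `𝒢` can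
terminate with the graph `𝒢'`.  The order in which decompositions are tried, and the choice among
several one-particle indices of maximal degree, are left open. -/
inductive InsertCall {κ : Type} (S : SymmetryData κ) :
    CompGraph κ → Multiset κ → CompGraph κ → Prop
  /-- `k` is already a node: return. -/
  | present (𝒢 : CompGraph κ) (k : Multiset κ) (hk : k ∈ 𝒢.nodes) : InsertCall S 𝒢 k 𝒢
  /-- `k` is the union of two nodes: add it. -/
  | split (𝒢 : CompGraph κ) (k k₁ k₂ : Multiset κ) (hk : k ∉ 𝒢.nodes)
      (h : 𝒢.Splits k k₁ k₂) : InsertCall S 𝒢 k (𝒢.addProduct k k₁ k₂)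
  /-- Otherwise split off an entry `a` of maximal degree, insert the rest `k'`, then call
  `Insert(k)` again. -/
  | recurse (𝒢 𝒢₁ 𝒢₂ : CompGraph κ) (k k' : Multiset κ) (a : κ) (hk : k ∉ 𝒢.nodes)
      (h : ∀ k₁ k₂, ¬ 𝒢.Splits k k₁ k₂)
      (hka : k = a ::ₘ k') (hmax : ∀ b ∈ k, S.deg b ≤ S.deg a)
      (h₁ : InsertCall S 𝒢 k' 𝒢₁) (h₂ : InsertCall S 𝒢₁ k 𝒢₂) : InsertCall S 𝒢 k 𝒢₂

/-- Successive calls of `Insert(k)` on the entries of a list. -/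
inductive InsertList {κ : Type} (S : SymmetryData κ) :
    CompGraph κ → List (Multiset κ) → CompGraph κ → Prop
  | nil (𝒢 : CompGraph κ) : InsertList S 𝒢 [] 𝒢
  | cons (𝒢 𝒢₁ 𝒢₂ : CompGraph κ) (k : Multiset κ) (L : List (Multiset κ))
      (h₁ : InsertCall S 𝒢 k 𝒢₁) (h₂ : InsertList S 𝒢₁ L 𝒢₂) : InsertList S 𝒢 (k :: L) 𝒢₂

namespace SymmetryData

variable {κ : Type}

/-- The graph that consists of all one-particle nodes `[a]` of degree `≤ D`. -/
def initialGraph (S : SymmetryData κ) (D : ℕ) : CompGraph κ where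
  nodes := {k | ∃ a : κ, S.deg a ≤ D ∧ k = {a}}
  products := ∅

/-- `L` lists the elements of `K_G(1, D) ∪ … ∪ K_G(ν, D)` in increasing correlation order. -/
def IsInsertionOrder (S : SymmetryData κ) (ν D : ℕ) (L : List (Multiset κ)) : Prop :=
  (∀ k, k ∈ L ↔ ∃ μ ∈ Finset.Icc 1 ν, k ∈ S.basisSet μ D) ∧
    L.Pairwise fun k k' => Multiset.card k ≤ Multiset.card k'

/-- `𝒢` is a possible outcome of the heuristic: starting from the one-particle nodes, all elements
of `K_G(1, D) ∪ … ∪ K_G(ν, D)` are inserted in increasing correlation order. -/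
def IsOutput (S : SymmetryData κ) (ν D : ℕ) (𝒢 : CompGraph κ) : Prop :=
  ∃ L, S.IsInsertionOrder ν D L ∧ InsertList S (S.initialGraph D) L 𝒢

/-- `A_G(ν, D)`: the auxiliary nodes of a graph, i.e. the non-invariant nodes that are not
one-particle nodes. -/
def auxNodes (S : SymmetryData κ) (𝒢 : CompGraph κ) : Set (Multiset κ) :=
  {k | k ∈ 𝒢.nodes ∧ 2 ≤ Multiset.card k ∧ k ∉ S.inv}

/-- `V_G(ν, D) = A_G(ν, D) ∪ K_G(1, D) ∪ … ∪ K_G(ν, D)`. -/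
def allNodes (S : SymmetryData κ) (ν D : ℕ) (𝒢 : CompGraph κ) : Set (Multiset κ) :=
  S.auxNodes 𝒢 ∪ ⋃ μ ∈ Finset.Icc 1 ν, S.basisSet μ D

/-- `#A_G(ν, D) / #V_G(ν, D)`. -/
noncomputable def auxRatio (S : SymmetryData κ) (ν D : ℕ) (𝒢 : CompGraph κ) : ℝ :=
  ((S.auxNodes 𝒢).ncard : ℝ) / ((S.allNodes ν D 𝒢).ncard : ℝ)

/-- For every degree `D` the heuristic has an outcome, and in every outcome the set `V_G(ν, D)`
(hence also `A_G(ν, D)`) is finite. -/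
def WellPosed (S : SymmetryData κ) (ν : ℕ) : Prop :=
  ∀ D : ℕ, (∃ 𝒢, S.IsOutput ν D 𝒢) ∧ ∀ 𝒢, S.IsOutput ν D 𝒢 → (S.allNodes ν D 𝒢).Finite

end SymmetryData

/-- `π(k, n)`: the number of integer partitions of `n` into exactly `k` (positive) parts. -/
def partitionCount (k n : ℕ) : ℕ :=
  (Finset.univ.filter fun p : n.Partition => Multiset.card p.parts = k).card

/-!
A call of `Insert` only ever adds the multi-index it is called with and parts of it. Hence the
heuristic terminates (the recursion removes an entry), all nodes lie in a finite set, and an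
auxiliary node, being a *proper* part of an invariant multi-index of order at most `ν`, has order
at most `ν - 1`. This is all that is needed for `SO(2)` and `O(3)`: if there are about `D ^ e`
one-particle indices of degree at most `D`, there are `O(D ^ (e (ν - 1)))` auxiliary nodes, while
the single linear constraint on the `m` leaves at least `c D ^ (e ν - 1)` invariant multi-indices
of order `ν` (`so2_le_ncard_basisSet`, `o3_le_ncard_basisSet`), where `e = 2` for `SO(2)` and
`e = 3` for `O(3)`; the parity condition costs only a constant factor.

For the torus the auxiliary nodes are determined exactly (`torus_auxNodes_eq`): they are the
multi-indices of order `2, …, ν - 1` and degree at most `D / 2` whose entries are all positive or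
all negative. When an invariant `k` of order `μ` is inserted, a zero entry can be split off, and the
positive and the negative part of `k` are both nodes already unless one of them has order `μ - 1`.
In that case `k = [n] + q` with `q` sign-definite, `n` is the unique entry of maximal degree, and
`Insert(q)` succeeds by splitting off one entry. Conversely, `[-∑ q] + q` splits in no other way
than into `[-∑ q]` and `q`, so every such `q` must have become a node; this is recorded in the
invariant `TorusState`.

Sign-definite multi-indices are partitions up to sign, and invariant ones are pairs of partitions
of the same number together with some zeros. The recurrence
`π(k + 1, n + k + 1) = π(k, n + k) + π(k + 1, n)` gives `π(k, n) ∼ n ^ (k - 1) / (k! (k - 1)!)`.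
With `m = ν - 1` and `N = ⌊D / 2⌋`, the auxiliary nodes number about `2 N ^ m / (m!) ^ 2`, and the
invariant multi-indices with `p` positive and `q = ν - p` negative entries about
`C(m, p) C(m, q) N ^ m / (m (m!) ^ 2)`. By Vandermonde's identity the latter sum to
`catalan m * N ^ m / (m!) ^ 2`, which gives the limit.
-/

/-! ### Runs of the insertion procedure -/

section Insertion

variable {κ : Type} {S : SymmetryData κ}

theorem InsertCall.nodes_mono {𝒢 𝒢' : CompGraph κ} {k : Multiset κ} (h : InsertCall S 𝒢 k 𝒢') :
    𝒢.nodes ⊆ 𝒢'.nodes := by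
  induction h with
  | present => exact subset_rfl
  | split => exact Set.subset_insert _ _
  | recurse _ _ _ _ _ _ _ _ _ _ _ _ ih₁ ih₂ => exact ih₁.trans ih₂

theorem InsertCall.mem_nodes {𝒢 𝒢' : CompGraph κ} {k : Multiset κ} (h : InsertCall S 𝒢 k 𝒢') :
    k ∈ 𝒢'.nodes := by
  induction h with
  | present _ _ hk => exact hk
  | split => exact Set.mem_insert _ _
  | recurse _ _ _ _ _ _ _ _ _ _ _ _ _ ih₂ => exact ih₂

theorem InsertCall.mem_or_le {𝒢 𝒢' : CompGraph κ} {k : Multiset κ} (h : InsertCall S 𝒢 k 𝒢') :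
    ∀ j ∈ 𝒢'.nodes, j ∈ 𝒢.nodes ∨ j ≤ k := by
  induction h with
  | present => exact fun j hj => Or.inl hj
  | split 𝒢 k k₁ k₂ =>
    rintro j (rfl | hj)
    · exact Or.inr le_rfl
    · exact Or.inl hj
  | recurse 𝒢 𝒢₁ 𝒢₂ k k' a _ _ hka _ _ _ ih₁ ih₂ =>
    intro j hj
    rcases ih₂ j hj with hj | hj
    · rcases ih₁ j hj with hj | hj
      · exact Or.inl hj
      · exact Or.inr (hj.trans (hka ▸ Multiset.le_cons_self k' a))
    · exact Or.inr hj

theorem InsertList.nodes_mono {𝒢 𝒢' : CompGraph κ} {L : List (Multiset κ)}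
    (h : InsertList S 𝒢 L 𝒢') : 𝒢.nodes ⊆ 𝒢'.nodes := by
  induction h with
  | nil => exact subset_rfl
  | cons _ _ _ _ _ h₁ _ ih => exact h₁.nodes_mono.trans ih

theorem InsertList.mem_or_le {𝒢 𝒢' : CompGraph κ} {L : List (Multiset κ)}
    (h : InsertList S 𝒢 L 𝒢') : ∀ j ∈ 𝒢'.nodes, j ∈ 𝒢.nodes ∨ ∃ k ∈ L, j ≤ k := by
  induction h with
  | nil => exact fun j hj => Or.inl hj
  | cons 𝒢 𝒢₁ 𝒢₂ k L h₁ _ ih =>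
    intro j hj
    rcases ih j hj with hj | ⟨k', hk', hj⟩
    · rcases h₁.mem_or_le j hj with hj | hj
      · exact Or.inl hj
      · exact Or.inr ⟨k, by simp, hj⟩
    · exact Or.inr ⟨k', by simp [hk'], hj⟩

/-- A call terminates as soon as all entries are one-particle nodes: after `Insert(k')` has
returned, `k = [a] + k'` is a union of two nodes, so the recursion is on the cardinality only. -/
theorem exists_insertCall {D : ℕ} (k : Multiset κ) (hk : k ≠ 0) (hdeg : ∀ a ∈ k, S.deg a ≤ D)
    (𝒢 : CompGraph κ) (h𝒢 : (S.initialGraph D).nodes ⊆ 𝒢.nodes) :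
    ∃ 𝒢', InsertCall S 𝒢 k 𝒢' := by
  induction hn : Multiset.card k generalizing k with
  | zero => exact absurd (Multiset.card_eq_zero.1 hn) hk
  | succ n ih =>
    by_cases hmem : k ∈ 𝒢.nodes
    · exact ⟨_, .present _ _ hmem⟩
    by_cases hs : ∃ k₁ k₂, 𝒢.Splits k k₁ k₂
    · obtain ⟨k₁, k₂, h⟩ := hs
      exact ⟨_, .split _ _ _ _ hmem h⟩
    push Not at hs
    obtain ⟨a, hak, hmax⟩ : ∃ a ∈ k, ∀ b ∈ k, S.deg b ≤ S.deg a := by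
      classical
      obtain ⟨a, ha, hmax⟩ := k.toFinset.exists_max_image S.deg
        (by simpa [Multiset.toFinset_nonempty] using hk)
      exact ⟨a, by simpa using ha, fun b hb => hmax b (by simpa using hb)⟩
    obtain ⟨k', rfl⟩ := Multiset.exists_cons_of_mem hak
    have hsingle : ({a} : Multiset κ) ∈ 𝒢.nodes := h𝒢 ⟨a, hdeg a hak, rfl⟩
    have hk' : k' ≠ 0 := by
      rintro rfl
      exact hmem hsingle
    obtain ⟨𝒢₁, h₁⟩ := ih k' hk' (fun b hb => hdeg b (Multiset.mem_cons_of_mem hb))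
      (by simpa using hn)
    have h₂ : ∃ 𝒢₂, InsertCall S 𝒢₁ (a ::ₘ k') 𝒢₂ := by
      by_cases hmem₁ : a ::ₘ k' ∈ 𝒢₁.nodes
      · exact ⟨_, .present _ _ hmem₁⟩
      · exact ⟨_, .split _ _ {a} k' hmem₁ ⟨by simp, hk', by simp, h₁.nodes_mono hsingle,
          h₁.mem_nodes⟩⟩
    obtain ⟨𝒢₂, h₂⟩ := h₂
    exact ⟨𝒢₂, .recurse _ _ _ _ _ _ hmem hs rfl hmax h₁ h₂⟩

theorem exists_insertList {D : ℕ} (L : List (Multiset κ))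
    (hL : ∀ k ∈ L, k ≠ 0 ∧ ∀ a ∈ k, S.deg a ≤ D)
    (𝒢 : CompGraph κ) (h𝒢 : (S.initialGraph D).nodes ⊆ 𝒢.nodes) :
    ∃ 𝒢', InsertList S 𝒢 L 𝒢' := by
  induction L generalizing 𝒢 with
  | nil => exact ⟨𝒢, .nil 𝒢⟩
  | cons k L ih =>
    obtain ⟨hk, hdeg⟩ := hL k (by simp)
    obtain ⟨𝒢₁, h₁⟩ := exists_insertCall k hk hdeg 𝒢 h𝒢
    obtain ⟨𝒢₂, h₂⟩ := ih (fun k' hk' => hL k' (by simp [hk'])) 𝒢₁ (h𝒢.trans h₁.nodes_mono)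
    exact ⟨𝒢₂, .cons _ _ _ _ _ h₁ h₂⟩

namespace SymmetryData

theorem deg_le_totalDeg (S : SymmetryData κ) {k : Multiset κ} {a : κ} (ha : a ∈ k) :
    S.deg a ≤ S.totalDeg k :=
  Multiset.single_le_sum (by simp) _ (Multiset.mem_map_of_mem _ ha)

/-- The multi-indices of correlation order at most `ν` with entries of degree at most `D`. -/
def boundedIndices (S : SymmetryData κ) (ν D : ℕ) : Set (Multiset κ) :=
  {k | Multiset.card k ≤ ν ∧ ∀ a ∈ k, S.deg a ≤ D}

/-- Padding a multi-index with `none` makes it the image of a tuple of length `ν`. -/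
theorem boundedIndices_subset_range (S : SymmetryData κ) (ν D : ℕ) :
    S.boundedIndices ν D ⊆ Set.range fun f : Fin ν → Option {a | S.deg a ≤ D} =>
      Multiset.filterMap (fun o => o.map Subtype.val) (Finset.univ.val.map f) := by
  rintro k ⟨hcard, hdeg⟩
  obtain ⟨l, rfl⟩ : ∃ l : List κ, (l : Multiset κ) = k := Quot.exists_rep k
  replace hdeg : ∀ a ∈ l, S.deg a ≤ D := fun a ha => hdeg a (Multiset.mem_coe.2 ha)
  have hlen : l.length ≤ ν := by simpa using hcard
  refine ⟨fun i => if h : (i : ℕ) < l.length then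
    some ⟨l[(i : ℕ)], hdeg _ (by simp)⟩ else none, ?_⟩
  obtain ⟨r, rfl⟩ := Nat.exists_eq_add_of_le hlen
  have : (Finset.univ.val : Multiset (Fin (l.length + r))) = ↑(List.finRange (l.length + r)) := rfl
  beta_reduce
  rw [this, Multiset.map_coe, Multiset.filterMap_coe]
  refine congrArg _ ?_
  rw [← List.ofFn_eq_map, List.ofFn_add, List.filterMap_append]
  have h1 : List.filterMap (fun o : Option {a | S.deg a ≤ D} => o.map Subtype.val)
      (List.ofFn fun i : Fin l.length =>
        (some ⟨l[(i : ℕ)], hdeg _ (by simp)⟩ : Option {a | S.deg a ≤ D})) = l := by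
    rw [List.ofFn_eq_map, List.filterMap_map]
    change List.filterMap (fun i : Fin l.length => some l[(i : ℕ)]) _ = l
    rw [← Function.comp_def some, List.filterMap_eq_map, ← List.ofFn_eq_map, List.ofFn_getElem]
  simpa using h1

theorem finite_boundedIndices (S : SymmetryData κ) (ν D : ℕ) (hfin : {a | S.deg a ≤ D}.Finite) :
    (S.boundedIndices ν D).Finite := by
  have := hfin.to_subtype
  exact (Set.finite_range _).subset (S.boundedIndices_subset_range ν D)

theorem ncard_boundedIndices_le (S : SymmetryData κ) (ν D : ℕ) (hfin : {a | S.deg a ≤ D}.Finite) :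
    (S.boundedIndices ν D).ncard ≤ ({a | S.deg a ≤ D}.ncard + 1) ^ ν := by
  classical
  have := hfin.fintype
  calc (S.boundedIndices ν D).ncard ≤ _ :=
        Set.ncard_le_ncard (S.boundedIndices_subset_range ν D) (Set.finite_range _)
    _ ≤ Nat.card (Fin ν → Option {a | S.deg a ≤ D}) := by
        rw [← Set.image_univ, ← Set.ncard_univ]
        exact Set.ncard_image_le
    _ = _ := by
        rw [Nat.card_eq_fintype_card, ← Nat.card_coe_set_eq, Nat.card_eq_fintype_card]
        simp

theorem basisSet_subset (S : SymmetryData κ) {μ ν D : ℕ} (h : μ ≤ ν) :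
    S.basisSet μ D ⊆ S.boundedIndices ν D :=
  fun _ hk => ⟨hk.2.2.trans_le h, fun _ ha => (S.deg_le_totalDeg ha).trans hk.2.1⟩

/-- Every node is an invariant multi-index, a one-particle node, or a proper part of an invariant
multi-index of order `≤ ν`; so the auxiliary nodes have order `< ν`. -/
theorem IsOutput.auxNodes_subset {ν D : ℕ} {𝒢 : CompGraph κ} (h : S.IsOutput ν D 𝒢) :
    S.auxNodes 𝒢 ⊆ S.boundedIndices (ν - 1) D := by
  obtain ⟨L, ⟨hL, -⟩, h⟩ := h
  rintro j ⟨hj, hcard, hinv⟩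
  rcases h.mem_or_le j hj with ⟨a, -, rfl⟩ | ⟨k, hk, hle⟩
  · simp at hcard
  · obtain ⟨μ, hμ, hk⟩ := (hL k).1 hk
    rw [Finset.mem_Icc] at hμ
    refine ⟨?_, fun a ha =>
      (S.deg_le_totalDeg (Multiset.mem_of_le hle ha)).trans hk.2.1⟩
    have hlt : j < k := lt_of_le_of_ne hle fun h => hinv (h ▸ hk.1)
    have := Multiset.card_lt_card hlt
    have := hk.2.2
    omega

theorem finite_iUnion_basisSet (S : SymmetryData κ) (ν D : ℕ) (hfin : {a | S.deg a ≤ D}.Finite) :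
    (⋃ μ ∈ Finset.Icc 1 ν, S.basisSet μ D).Finite :=
  (S.finite_boundedIndices ν D hfin).subset <| Set.iUnion₂_subset fun _ hμ =>
    S.basisSet_subset (Finset.mem_Icc.1 hμ).2

theorem IsOutput.finite_auxNodes {ν D : ℕ} {𝒢 : CompGraph κ} (h : S.IsOutput ν D 𝒢)
    (hfin : {a | S.deg a ≤ D}.Finite) : (S.auxNodes 𝒢).Finite :=
  (S.finite_boundedIndices _ D hfin).subset h.auxNodes_subset

theorem wellPosed (S : SymmetryData κ) (ν : ℕ) (hfin : ∀ D, {a | S.deg a ≤ D}.Finite)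
    (h0 : (0 : Multiset κ) ∉ S.inv) : S.WellPosed ν := by
  intro D
  refine ⟨?_, fun 𝒢 h =>
    (h.finite_auxNodes (hfin D)).union (S.finite_iUnion_basisSet ν D (hfin D))⟩
  have hK := S.finite_iUnion_basisSet ν D (hfin D)
  let L := hK.toFinset.toList.insertionSort fun k k' => Multiset.card k ≤ Multiset.card k'
  have : Std.Total fun k k' : Multiset κ => Multiset.card k ≤ Multiset.card k' :=
    ⟨fun _ _ => le_total _ _⟩
  have : IsTrans (Multiset κ) fun k k' => Multiset.card k ≤ Multiset.card k' :=
    ⟨fun _ _ _ => le_trans⟩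
  have hL : ∀ k, k ∈ L ↔ ∃ μ ∈ Finset.Icc 1 ν, k ∈ S.basisSet μ D := by
    intro k
    simp [L, List.mem_insertionSort]
  obtain ⟨𝒢, h𝒢⟩ := exists_insertList (S := S) (D := D) L (fun k hk => by
    obtain ⟨μ, -, hk⟩ := (hL k).1 hk
    exact ⟨fun h => h0 (h ▸ hk.1), fun a ha => (S.deg_le_totalDeg ha).trans hk.2.1⟩)
    (S.initialGraph D) subset_rfl
  exact ⟨𝒢, L, ⟨hL, List.pairwise_insertionSort _ _⟩, h𝒢⟩

theorem IsOutput.ncard_allNodes {ν D : ℕ} {𝒢 : CompGraph κ} (h : S.IsOutput ν D 𝒢)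
    (hfin : {a | S.deg a ≤ D}.Finite) : (S.allNodes ν D 𝒢).ncard =
      (S.auxNodes 𝒢).ncard + (⋃ μ ∈ Finset.Icc 1 ν, S.basisSet μ D).ncard := by
  refine Set.ncard_union_eq ?_ (h.finite_auxNodes hfin) (S.finite_iUnion_basisSet ν D hfin)
  refine Set.disjoint_left.2 fun k hk hk' => hk.2.2 ?_
  obtain ⟨μ, -, hk'⟩ := Set.mem_iUnion₂.1 hk'
  exact hk'.1

end SymmetryData

end Insertion

/-! ### The auxiliary nodes for the torus -/

section Torus

/-- A multi-index of the torus is sign-definite if its entries are all positive or all negative. -/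
def SignDefinite (k : Multiset ℤ) : Prop :=
  (∀ a ∈ k, 0 < a) ∨ (∀ a ∈ k, a < 0)

theorem SignDefinite.mono {j k : Multiset ℤ} (hk : SignDefinite k) (h : j ≤ k) :
    SignDefinite j :=
  hk.imp (fun H a ha => H a (Multiset.mem_of_le h ha)) fun H a ha => H a (Multiset.mem_of_le h ha)

theorem torus_totalDeg_add (j k : Multiset ℤ) :
    torus.totalDeg (j + k) = torus.totalDeg j + torus.totalDeg k := by
  simp [SymmetryData.totalDeg]

theorem torus_totalDeg_cons (a : ℤ) (k : Multiset ℤ) :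
    torus.totalDeg (a ::ₘ k) = a.natAbs + torus.totalDeg k := by
  simp [SymmetryData.totalDeg, torus]

theorem torus_totalDeg_singleton (a : ℤ) : torus.totalDeg {a} = a.natAbs := by
  simp [SymmetryData.totalDeg, torus]

theorem totalDeg_of_pos {k : Multiset ℤ} (h : ∀ a ∈ k, 0 < a) :
    (torus.totalDeg k : ℤ) = k.sum := by
  induction k using Multiset.induction with
  | empty => simp [SymmetryData.totalDeg]
  | cons a k ih =>
    have := ih fun b hb => h b (Multiset.mem_cons_of_mem hb)
    have := h a (Multiset.mem_cons_self a k)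
    rw [torus_totalDeg_cons, Multiset.sum_cons]
    omega

theorem totalDeg_of_neg {k : Multiset ℤ} (h : ∀ a ∈ k, a < 0) :
    (torus.totalDeg k : ℤ) = -k.sum := by
  induction k using Multiset.induction with
  | empty => simp [SymmetryData.totalDeg]
  | cons a k ih =>
    have := ih fun b hb => h b (Multiset.mem_cons_of_mem hb)
    have := h a (Multiset.mem_cons_self a k)
    rw [torus_totalDeg_cons, Multiset.sum_cons]
    omega

theorem SignDefinite.totalDeg_eq {k : Multiset ℤ} (h : SignDefinite k) :
    torus.totalDeg k = k.sum.natAbs := by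
  rcases h with h | h
  · have := totalDeg_of_pos h
    omega
  · have := totalDeg_of_neg h
    omega

theorem SignDefinite.ne_zero_of_mem {k : Multiset ℤ} (h : SignDefinite k) {a : ℤ} (ha : a ∈ k) :
    a ≠ 0 := by
  rcases h with h | h
  · exact (h a ha).ne'
  · exact (h a ha).ne

theorem SignDefinite.sum_ne_zero {k : Multiset ℤ} (h : SignDefinite k) (hk : k ≠ 0) :
    k.sum ≠ 0 := by
  obtain ⟨a, ha⟩ := Multiset.exists_mem_of_ne_zero hk
  have h1 := h.totalDeg_eq
  have h2 : a.natAbs ≤ _ := torus.deg_le_totalDeg ha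
  have h3 := h.ne_zero_of_mem ha
  omega

theorem SignDefinite.notMem_inv {k : Multiset ℤ} (h : SignDefinite k) : k ∉ torus.inv :=
  fun hk => h.sum_ne_zero hk.1 hk.2

/-- In a sign-definite multi-index of order at least two every entry has smaller degree than the
whole. -/
theorem SignDefinite.natAbs_lt {k : Multiset ℤ} (h : SignDefinite k) (hk : 2 ≤ Multiset.card k)
    {a : ℤ} (ha : a ∈ k) : a.natAbs < torus.totalDeg k := by
  obtain ⟨k', rfl⟩ := Multiset.exists_cons_of_mem ha
  rw [Multiset.card_cons] at hk
  obtain ⟨b, hb⟩ := Multiset.card_pos_iff_exists_mem.1 (show 0 < Multiset.card k' by omega)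
  have h2 : b.natAbs ≤ _ := torus.deg_le_totalDeg hb
  have h3 := h.ne_zero_of_mem (Multiset.mem_cons_of_mem hb)
  rw [torus_totalDeg_cons]
  omega

/-- An invariant multi-index without zero entries is the union of its positive and its negative
part. -/
theorem exists_signDefinite_add {k : Multiset ℤ} (hk : k ∈ torus.inv) (h0 : (0 : ℤ) ∉ k) :
    ∃ p q, k = p + q ∧ p ≠ 0 ∧ q ≠ 0 ∧ SignDefinite p ∧ SignDefinite q ∧
      p.sum = -q.sum := by
  have hadd : k.filter (0 < ·) + k.filter (fun a => ¬ 0 < a) = k := Multiset.filter_add_not _ k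
  have hp : ∀ a ∈ k.filter (0 < ·), 0 < a := fun a ha => (Multiset.mem_filter.1 ha).2
  have hq : ∀ a ∈ k.filter (fun a => ¬ 0 < a), a < 0 := fun a ha => by
    obtain ⟨ha, hna⟩ := Multiset.mem_filter.1 ha
    have : a ≠ 0 := fun h => h0 (h ▸ ha)
    omega
  generalize k.filter (0 < ·) = p at *
  generalize k.filter (fun a => ¬ 0 < a) = q at *
  obtain ⟨hne, hsum⟩ := hk
  rw [← hadd, Multiset.sum_add] at hsum
  refine ⟨p, q, hadd.symm, ?_, ?_, Or.inl hp, Or.inr hq, by omega⟩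
  · rintro rfl
    rw [zero_add] at hadd
    exact SignDefinite.sum_ne_zero (k := q) (Or.inr hq) (by rwa [hadd]) (by simpa using hsum)
  · rintro rfl
    rw [add_zero] at hadd
    exact SignDefinite.sum_ne_zero (k := p) (Or.inl hp) (by rwa [hadd]) (by simpa using hsum)

/-- The state of the graph while the heuristic for the torus runs. -/
structure TorusState (ν D : ℕ) (𝒢 : CompGraph ℤ) : Prop where
  /-- The one-particle nodes are nodes. -/
  initial : (torus.initialGraph D).nodes ⊆ 𝒢.nodes
  /-- Apart from these, only invariant and short sign-definite multi-indices are nodes. -/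
  sound : ∀ j ∈ 𝒢.nodes, j ∈ (torus.initialGraph D).nodes ∨ j ∈ torus.inv ∨
    (SignDefinite j ∧ 2 ≤ Multiset.card j ∧ Multiset.card j ≤ ν - 1 ∧ 2 * torus.totalDeg j ≤ D)
  /-- If the invariant multi-index with negative part `q` and a single positive entry (or vice
  versa) is a node, then `q` is a node. -/
  link : ∀ n q, SignDefinite q → 2 ≤ Multiset.card q → n ::ₘ q ∈ torus.inv → n ::ₘ q ∈ 𝒢.nodes →
    q ∈ 𝒢.nodes

theorem torusState_initialGraph (ν D : ℕ) : TorusState ν D (torus.initialGraph D) where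
  initial := subset_rfl
  sound _ hj := Or.inl hj
  link n q _ hq _ h := by
    obtain ⟨a, -, h⟩ := h
    have := congrArg Multiset.card h
    simp at this
    simp [this] at hq

/-- The invariant multi-index `[-∑ q] + q` closes up the multi-index `q`. -/
theorem neg_sum_cons_mem_basisSet {q : Multiset ℤ} (hq : SignDefinite q) {D : ℕ}
    (hdeg : 2 * torus.totalDeg q ≤ D) :
    (-q.sum) ::ₘ q ∈ torus.basisSet (Multiset.card q + 1) D := by
  refine ⟨⟨by simp, by simp⟩, ?_, by simp⟩
  rw [torus_totalDeg_cons]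
  have := hq.totalDeg_eq
  omega

namespace TorusState

variable {ν D : ℕ} {𝒢 : CompGraph ℤ}

theorem singleton_mem (h : TorusState ν D 𝒢) {a : ℤ} (ha : a.natAbs ≤ D) :
    ({a} : Multiset ℤ) ∈ 𝒢.nodes :=
  h.initial ⟨a, ha, rfl⟩

/-- Once all invariant multi-indices of order `< μ` have been inserted, the sign-definite
multi-indices of order `≤ μ - 2` and degree at most `D / 2` are nodes. -/
theorem mem_of_signDefinite (h : TorusState ν D 𝒢) {μ : ℕ}
    (hlow : ∀ i < μ, torus.basisSet i D ⊆ 𝒢.nodes)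
    {q : Multiset ℤ} (hq : SignDefinite q) (hq0 : q ≠ 0) (hcard : Multiset.card q + 1 < μ)
    (hdeg : 2 * torus.totalDeg q ≤ D) : q ∈ 𝒢.nodes := by
  have hpos := Multiset.card_pos.2 hq0
  by_cases h1 : Multiset.card q = 1
  · obtain ⟨a, rfl⟩ := Multiset.card_eq_one.1 h1
    rw [torus_totalDeg_singleton] at hdeg
    exact h.singleton_mem (by omega)
  · have hK := neg_sum_cons_mem_basisSet hq hdeg
    exact h.link _ q hq (by omega) hK.1 (hlow _ hcard hK)

/-- Adding an invariant node that is a union of two nodes. -/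
theorem addProduct_inv (h : TorusState ν D 𝒢) {k k₁ k₂ : Multiset ℤ} (hk : k ∈ torus.inv)
    (hs : 𝒢.Splits k k₁ k₂) : TorusState ν D (𝒢.addProduct k k₁ k₂) where
  initial := h.initial.trans (Set.subset_insert _ _)
  sound := by
    rintro j (rfl | hj)
    · exact Or.inr (Or.inl hk)
    · exact h.sound j hj
  link n q hq hcard hinv hmem := by
    refine Set.mem_insert_of_mem _ ?_
    rcases hmem with hmem | hmem
    swap
    · exact h.link n q hq hcard hinv hmem
    obtain ⟨h1, h2, hadd, hm1, hm2⟩ := hs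
    -- A part of `k = [n] + q` that lies within `q` is not invariant, so neither is the other part;
    -- hence both parts are sign-definite, and the one that contains `n` is `[n]`.
    have hsum : n + q.sum = 0 := by simpa using hinv.2
    have hn0 : n ≠ 0 := by
      have := hq.sum_ne_zero (by rintro rfl; simp at hcard)
      omega
    have key : ∀ j₁ j₂ : Multiset ℤ, j₂ ≠ 0 → n ::ₘ q = j₁ + j₂ → n ∈ j₁ → j₁ ∈ 𝒢.nodes →
        j₂ ∈ 𝒢.nodes → q ∈ 𝒢.nodes := by
      intro j₁ j₂ hj₂ hadd hn hj₁m hj₂m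
      obtain ⟨r, rfl⟩ := Multiset.exists_cons_of_mem hn
      rw [Multiset.cons_add, Multiset.cons_inj_right] at hadd
      have hj₂def : SignDefinite j₂ := hq.mono (hadd ▸ Multiset.le_add_left _ _)
      by_cases hr : r = 0
      · rw [hr, zero_add] at hadd
        exact hadd ▸ hj₂m
      exfalso
      have hrcard := Multiset.card_pos.2 hr
      have hr_sum : n + r.sum + j₂.sum = 0 := by
        rw [hadd, Multiset.sum_add] at hsum
        omega
      have hj₂sum := hj₂def.sum_ne_zero hj₂
      rcases h.sound _ hj₁m with ⟨a, -, ha⟩ | hi | ⟨hd, -⟩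
      · have := congrArg Multiset.card ha
        exact hr (by simpa using this)
      · have := hi.2
        rw [Multiset.sum_cons] at this
        omega
      · obtain ⟨b, hb⟩ := Multiset.exists_mem_of_ne_zero hr
        have hbq : b ∈ q := hadd ▸ Multiset.mem_add.2 (Or.inl hb)
        have hbd := hd.imp (fun H => And.intro (H n (by simp)) (H b (by simp [hb])))
          fun H => And.intro (H n (by simp)) (H b (by simp [hb]))
        have hqd := hq.imp (fun H => And.intro (H b hbq) (totalDeg_of_pos H))
          fun H => And.intro (H b hbq) (totalDeg_of_neg H)
        omega
    have hn : n ∈ k₁ + k₂ := by rw [← hadd, ← hmem]; simp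
    rcases Multiset.mem_add.1 hn with hn | hn
    · exact key k₁ k₂ h2 (hmem.trans hadd) hn hm1 hm2
    · exact key k₂ k₁ h1 (hmem.trans (hadd.trans (add_comm _ _))) hn hm2 hm1

theorem addProduct_signDefinite (h : TorusState ν D 𝒢) {k : Multiset ℤ} (k₁ k₂ : Multiset ℤ)
    (hk : SignDefinite k) (hcard : 2 ≤ Multiset.card k) (hcard' : Multiset.card k ≤ ν - 1)
    (hdeg : 2 * torus.totalDeg k ≤ D) :
    TorusState ν D (𝒢.addProduct k k₁ k₂) where
  initial := h.initial.trans (Set.subset_insert _ _)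
  sound := by
    rintro j (rfl | hj)
    · exact Or.inr (Or.inr ⟨hk, hcard, hcard', hdeg⟩)
    · exact h.sound j hj
  link n q hq hc hinv hmem := by
    refine Set.mem_insert_of_mem _ ?_
    rcases hmem with rfl | hmem
    · exact absurd hinv hk.notMem_inv
    · exact h.link n q hq hc hinv hmem

/-- `Insert(k)` for an invariant `k`: if it recurses at all, then `k = [a] + k'` with `k'`
sign-definite, and the call `Insert(k')` finds that `k'` is a union of two nodes. -/
theorem insertCall (h : TorusState ν D 𝒢) {k : Multiset ℤ} {μ : ℕ}
    (hlow : ∀ i < μ, torus.basisSet i D ⊆ 𝒢.nodes) (hμ : μ ≤ ν) (hk : k ∈ torus.basisSet μ D)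
    {𝒢' : CompGraph ℤ} (hcall : InsertCall torus 𝒢 k 𝒢') : TorusState ν D 𝒢' := by
  obtain ⟨hinv, hdeg, hcard⟩ := hk
  cases hcall with
  | present => exact h
  | split _ _ k₁ k₂ _ hs => exact h.addProduct_inv hinv hs
  | recurse 𝒢 𝒢₁ 𝒢₂ k k' a hmem hns hka hmax h₁ h₂ =>
    have h0 : (0 : ℤ) ∉ k := by
      intro h0
      obtain ⟨r, rfl⟩ := Multiset.exists_cons_of_mem h0
      have hr : r ≠ 0 := by
        rintro rfl
        exact hmem (h.singleton_mem (by simp))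
      refine hns {0} r ⟨by simp, hr, by simp, h.singleton_mem (by simp), ?_⟩
      rw [Multiset.card_cons] at hcard
      refine hlow (Multiset.card r) (by omega) ⟨⟨hr, by simpa using hinv.2⟩, ?_, rfl⟩
      rw [torus_totalDeg_cons] at hdeg
      omega
    obtain ⟨n, q, rfl, hq, hqcard⟩ : ∃ n q, k = n ::ₘ q ∧ SignDefinite q ∧
        2 ≤ Multiset.card q := by
      obtain ⟨p, q, rfl, hp0, hq0, hp, hq, hpq⟩ := exists_signDefinite_add hinv h0
      have hp1 := Multiset.card_pos.2 hp0
      have hq1 := Multiset.card_pos.2 hq0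
      rw [Multiset.card_add] at hcard
      have hpd : 2 * torus.totalDeg p ≤ D := by
        rw [torus_totalDeg_add, hp.totalDeg_eq, hq.totalDeg_eq] at hdeg
        rw [hp.totalDeg_eq]
        omega
      have hqd : 2 * torus.totalDeg q ≤ D := by
        rw [torus_totalDeg_add, hp.totalDeg_eq, hq.totalDeg_eq] at hdeg
        rw [hq.totalDeg_eq]
        omega
      by_cases hpc : Multiset.card p = 1
      · obtain ⟨n, rfl⟩ := Multiset.card_eq_one.1 hpc
        rw [torus_totalDeg_singleton] at hpd
        refine ⟨n, q, by simp, hq, ?_⟩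
        by_contra hlt
        obtain ⟨m, rfl⟩ := Multiset.card_eq_one.1 (show Multiset.card q = 1 by omega)
        rw [torus_totalDeg_singleton] at hqd
        exact hns {n} {m} ⟨hp0, hq0, rfl, h.singleton_mem (by omega), h.singleton_mem (by omega)⟩
      by_cases hqc : Multiset.card q = 1
      · obtain ⟨n, rfl⟩ := Multiset.card_eq_one.1 hqc
        exact ⟨n, p, by rw [add_comm]; simp, hp, by omega⟩
      · exact absurd ⟨hp0, hq0, rfl, h.mem_of_signDefinite hlow hp hp0 (by omega) hpd,
          h.mem_of_signDefinite hlow hq hq0 (by omega) hqd⟩ (hns p q)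
    have hq0 : q ≠ 0 := by
      rintro rfl
      simp at hqcard
    have hsum : n + q.sum = 0 := by simpa using hinv.2
    have hqdeg := hq.totalDeg_eq
    rw [torus_totalDeg_cons] at hdeg
    rw [Multiset.card_cons] at hcard
    have han : n = a := by
      have ha : a ∈ n ::ₘ q := by rw [hka]; simp
      rcases Multiset.mem_cons.1 ha with ha | ha
      · exact ha.symm
      · have := hq.natAbs_lt hqcard ha
        have : n.natAbs ≤ a.natAbs := hmax n (by simp)
        omega
    subst han
    have hqk := (Multiset.cons_inj_right _).1 hka
    subst hqk
    have hqD : 2 * torus.totalDeg q ≤ D := by omega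
    have hnmem : ({n} : Multiset ℤ) ∈ 𝒢.nodes := h.singleton_mem (by omega)
    have hqmem : q ∉ 𝒢.nodes := fun hqm => hns {n} q ⟨by simp, hq0, by simp, hnmem, hqm⟩
    have hstate₁ : TorusState ν D 𝒢₁ := by
      cases h₁ with
      | present => exact h
      | split _ _ k₁ k₂ _ hs =>
        exact h.addProduct_signDefinite k₁ k₂ hq hqcard (by omega) hqD
      | recurse _ _ _ _ r b _ hns' hqb _ _ _ =>
        exfalso
        rw [hqb, Multiset.card_cons] at hqcard hcard
        rw [hqb, torus_totalDeg_cons] at hqD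
        have hr0 : r ≠ 0 := by
          rintro rfl
          simp at hqcard
        refine hns' {b} r ⟨by simp, hr0, by simpa using hqb, h.singleton_mem (by omega), ?_⟩
        exact h.mem_of_signDefinite hlow (hq.mono (hqb ▸ Multiset.le_cons_self r b)) hr0
          (by omega) (by omega)
    cases h₂ with
    | present => exact hstate₁
    | split _ _ k₁ k₂ _ hs => exact hstate₁.addProduct_inv hinv hs
    | recurse _ _ _ _ _ _ _ hns₂ =>
      exact absurd ⟨by simp, hq0, by simp, hstate₁.singleton_mem (by omega), h₁.mem_nodes⟩
        (hns₂ {n} q)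

theorem insertList {L : List (Multiset ℤ)} {𝒢' : CompGraph ℤ}
    (hlist : InsertList torus 𝒢 L 𝒢') (h : TorusState ν D 𝒢)
    (hL : ∀ k ∈ L, ∃ μ ≤ ν, k ∈ torus.basisSet μ D)
    (hsort : L.Pairwise fun k k' => Multiset.card k ≤ Multiset.card k')
    (hall : ∀ μ ≤ ν, ∀ k ∈ torus.basisSet μ D, k ∈ 𝒢.nodes ∨ k ∈ L) :
    TorusState ν D 𝒢' ∧ ∀ μ ≤ ν, torus.basisSet μ D ⊆ 𝒢'.nodes := by
  induction hlist with
  | nil => exact ⟨h, fun μ hμ k hk => (hall μ hμ k hk).resolve_right (by simp)⟩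
  | cons 𝒢 𝒢₁ 𝒢₂ k L h₁ h₂ ih =>
    obtain ⟨μ, hμ, hk⟩ := hL k (by simp)
    rw [List.pairwise_cons] at hsort
    refine ih (h.insertCall ?_ hμ hk h₁) (fun k' hk' => hL k' (by simp [hk'])) hsort.2 ?_
    · intro i hi j hj
      refine (hall i (by omega) j hj).resolve_right fun hjL => ?_
      have hk2 := hk.2.2
      have hj2 := hj.2.2
      rcases List.mem_cons.1 hjL with rfl | hjL
      · omega
      · have := hsort.1 j hjL
        omega
    · intro i hi j hj
      rcases hall i hi j hj with hj | hj
      · exact Or.inl (h₁.nodes_mono hj)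
      · rcases List.mem_cons.1 hj with rfl | hj
        · exact Or.inl h₁.mem_nodes
        · exact Or.inr hj

end TorusState

/-- The auxiliary nodes for the torus do not depend on the choices made by the heuristic. -/
theorem torus_auxNodes_eq {ν D : ℕ} {𝒢 : CompGraph ℤ} (h : torus.IsOutput ν D 𝒢) :
    torus.auxNodes 𝒢 = {q | SignDefinite q ∧ 2 ≤ Multiset.card q ∧ Multiset.card q ≤ ν - 1 ∧
      2 * torus.totalDeg q ≤ D} := by
  obtain ⟨L, ⟨hL, hsort⟩, hlist⟩ := h
  obtain ⟨hstate, hall⟩ := TorusState.insertList hlist (torusState_initialGraph ν D)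
    (fun k hk => by
      obtain ⟨μ, hμ, hk⟩ := (hL k).1 hk
      exact ⟨μ, (Finset.mem_Icc.1 hμ).2, hk⟩) hsort
    (fun μ hμ k hk => Or.inr <| (hL k).2 ⟨μ, Finset.mem_Icc.2
      ⟨hk.2.2 ▸ Multiset.card_pos.2 hk.1.1, hμ⟩, hk⟩)
  ext q
  constructor
  · rintro ⟨hq, hcard, hinv⟩
    rcases hstate.sound q hq with ⟨a, -, rfl⟩ | hi | h
    · simp at hcard
    · exact absurd hi hinv
    · exact h
  · rintro ⟨hq, hcard, hcard', hdeg⟩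
    have hK := neg_sum_cons_mem_basisSet hq hdeg
    exact ⟨hstate.link _ q hq hcard hK.1 (hall _ (by omega) hK), hcard, hq.notMem_inv⟩

end Torus

/-! ### Partitions with a given number of parts -/

section Partitions

/-- The partitions of `n` into exactly `k` positive parts, as multisets. -/
def partsFinset (k n : ℕ) : Finset (Multiset ℕ) :=
  (Finset.univ.filter fun p : n.Partition => Multiset.card p.parts = k).image Nat.Partition.parts

theorem mem_partsFinset {k n : ℕ} {s : Multiset ℕ} :
    s ∈ partsFinset k n ↔ Multiset.card s = k ∧ s.sum = n ∧ ∀ a ∈ s, 0 < a := by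
  simp only [partsFinset, Finset.mem_image, Finset.mem_filter, Finset.mem_univ, true_and]
  constructor
  · rintro ⟨p, hp, rfl⟩
    exact ⟨hp, p.parts_sum, fun a ha => p.parts_pos ha⟩
  · rintro ⟨hk, hn, hpos⟩
    exact ⟨⟨s, fun {a} ha => hpos a ha, hn⟩, hk, rfl⟩

theorem card_partsFinset (k n : ℕ) : (partsFinset k n).card = partitionCount k n := by
  rw [partsFinset, Finset.card_image_of_injective _ fun p q h => Nat.Partition.ext h]
  rfl

theorem partitionCount_zero_left (n : ℕ) : partitionCount 0 n = if n = 0 then 1 else 0 := by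
  rw [← card_partsFinset]
  split_ifs with h
  · rw [Finset.card_eq_one]
    refine ⟨0, Finset.ext fun s => ?_⟩
    rw [mem_partsFinset, Finset.mem_singleton, Multiset.card_eq_zero]
    exact ⟨fun hs => hs.1, by rintro rfl; simp [h]⟩
  · rw [Finset.card_eq_zero, Finset.eq_empty_iff_forall_notMem]
    intro s hs
    rw [mem_partsFinset, Multiset.card_eq_zero] at hs
    obtain ⟨rfl, hs, -⟩ := hs
    exact h (by simpa using hs.symm)

theorem le_sum_of_forall_pos {s : Multiset ℕ} (h : ∀ a ∈ s, 0 < a) : Multiset.card s ≤ s.sum := by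
  have := Multiset.card_nsmul_le_sum (s := s) (a := 1) fun a ha => h a ha
  simpa using this

theorem partitionCount_of_lt {k n : ℕ} (h : n < k) : partitionCount k n = 0 := by
  rw [← card_partsFinset, Finset.card_eq_zero, Finset.eq_empty_iff_forall_notMem]
  intro s hs
  rw [mem_partsFinset] at hs
  have := le_sum_of_forall_pos hs.2.2
  omega

theorem sum_map_succ (s : Multiset ℕ) : (s.map Nat.succ).sum = s.sum + Multiset.card s := by
  have : (Nat.succ : ℕ → ℕ) = fun a => a + 1 := rfl
  rw [this, Multiset.sum_map_add]
  simp

/-- Either `1` is a part, or all parts can be lowered by `1`. -/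
theorem partitionCount_succ (k n : ℕ) : partitionCount (k + 1) (n + k + 1) =
    partitionCount k (n + k) + partitionCount (k + 1) n := by
  have hset : partsFinset (k + 1) (n + k + 1) =
      (partsFinset k (n + k)).image (fun s => 1 ::ₘ s) ∪
        (partsFinset (k + 1) n).image (Multiset.map Nat.succ) := by
    ext s
    simp only [Finset.mem_union, Finset.mem_image, mem_partsFinset]
    constructor
    · rintro ⟨hc, hs, hpos⟩
      by_cases h1 : 1 ∈ s
      · obtain ⟨t, rfl⟩ := Multiset.exists_cons_of_mem h1
        rw [Multiset.card_cons] at hc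
        rw [Multiset.sum_cons] at hs
        exact Or.inl ⟨t, ⟨by omega, by omega, fun a ha => hpos a (Multiset.mem_cons_of_mem ha)⟩,
          rfl⟩
      · have hmap : (s.map Nat.pred).map Nat.succ = s := by
          rw [Multiset.map_map]
          conv_rhs => rw [← Multiset.map_id s]
          exact Multiset.map_congr rfl fun a ha => Nat.succ_pred (hpos a ha).ne'
        have hsum := sum_map_succ (s.map Nat.pred)
        rw [hmap, Multiset.card_map] at hsum
        refine Or.inr ⟨s.map Nat.pred, ⟨by simpa using hc, by omega, fun b hb => ?_⟩, hmap⟩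
        obtain ⟨a, ha, rfl⟩ := Multiset.mem_map.1 hb
        have := hpos a ha
        have : a ≠ 1 := fun h => h1 (h ▸ ha)
        simp only [Nat.pred_eq_sub_one]
        omega
    · rintro (⟨t, ⟨hc, hs, hpos⟩, rfl⟩ | ⟨t, ⟨hc, hs, hpos⟩, rfl⟩)
      · refine ⟨by simp [hc], by simp [hs]; omega, fun a ha => ?_⟩
        rcases Multiset.mem_cons.1 ha with rfl | ha
        · exact one_pos
        · exact hpos a ha
      · refine ⟨by simpa using hc, by rw [sum_map_succ]; omega, fun a ha => ?_⟩
        obtain ⟨b, -, rfl⟩ := Multiset.mem_map.1 ha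
        exact Nat.succ_pos b
  rw [← card_partsFinset, hset, Finset.card_union_of_disjoint, Finset.card_image_of_injective,
    Finset.card_image_of_injective, card_partsFinset, card_partsFinset]
  · exact Multiset.map_injective Nat.succ_injective
  · exact fun s t h => (Multiset.cons_inj_right 1).1 h
  · rw [Finset.disjoint_left]
    rintro s hs ht
    obtain ⟨t, -, rfl⟩ := Finset.mem_image.1 hs
    obtain ⟨u, hu, hut⟩ := Finset.mem_image.1 ht
    have h1 : 1 ∈ u.map Nat.succ := by
      rw [hut]
      exact Multiset.mem_cons_self 1 t
    obtain ⟨b, hb, hb1⟩ := Multiset.mem_map.1 h1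
    have := (mem_partsFinset.1 hu).2.2 b hb
    omega

theorem partitionCount_one {n : ℕ} (hn : 0 < n) : partitionCount 1 n = 1 := by
  induction n with
  | zero => omega
  | succ n ih =>
    have := partitionCount_succ 0 n
    simp only [zero_add, add_zero] at this
    rw [this, partitionCount_zero_left]
    rcases Nat.eq_zero_or_pos n with rfl | h
    · simp [partitionCount_of_lt]
    · rw [ih h, if_neg h.ne']

/-- The Bernoulli-type inequality `a^(m+1) + (m+1) d a^m ≤ (a+d)^(m+1)`. -/
theorem pow_add_mul_pow_le (a d m : ℕ) :
    a ^ (m + 1) + (m + 1) * d * a ^ m ≤ (a + d) ^ (m + 1) := by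
  induction m with
  | zero => simp
  | succ m ih =>
    have h : a ^ (m + 1) ≤ (a + d) ^ (m + 1) := Nat.pow_le_pow_left (by omega) _
    calc a ^ (m + 1 + 1) + (m + 1 + 1) * d * a ^ (m + 1)
        = (a ^ (m + 1) + (m + 1) * d * a ^ m) * a + a ^ (m + 1) * d := by ring
      _ ≤ (a + d) ^ (m + 1) * a + (a + d) ^ (m + 1) * d := by gcongr
      _ = _ := by ring

/-- The companion upper bound `(a+d)^(m+1) ≤ a^(m+1) + (m+1) d (a+d)^m`. -/
theorem pow_le_pow_add_mul (a d m : ℕ) :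
    (a + d) ^ (m + 1) ≤ a ^ (m + 1) + (m + 1) * d * (a + d) ^ m := by
  induction m with
  | zero => simp
  | succ m ih =>
    have h : a ≤ a + d := by omega
    calc (a + d) ^ (m + 1 + 1) = (a + d) ^ (m + 1) * a + d * (a + d) ^ (m + 1) := by ring
      _ ≤ (a ^ (m + 1) + (m + 1) * d * (a + d) ^ m) * a + d * (a + d) ^ (m + 1) := by gcongr
      _ = a ^ (m + 1 + 1) + (m + 1) * d * (a + d) ^ m * a + d * (a + d) ^ (m + 1) := by ring
      _ ≤ a ^ (m + 1 + 1) + (m + 1) * d * (a + d) ^ m * (a + d) + d * (a + d) ^ (m + 1) := by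
        gcongr
      _ = _ := by ring

/-- Upper bound from the recurrence: the shift `(k+1)k/2` makes the right-hand side grow fast
enough. -/
theorem factorial_mul_partitionCount_le (k n : ℕ) :
    (k + 1).factorial * k.factorial * partitionCount (k + 1) n ≤ (n + (k + 1).choose 2) ^ k := by
  induction k generalizing n with
  | zero =>
    rcases Nat.eq_zero_or_pos n with rfl | h
    · simp [partitionCount_of_lt]
    · simp [partitionCount_one h]
  | succ k ih =>
    induction n using Nat.strong_induction_on with
    | _ n ihn =>
      rcases lt_or_ge n (k + 1 + 1) with h | h
      · simp [partitionCount_of_lt h]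
      obtain ⟨r, rfl⟩ := Nat.exists_eq_add_of_le h
      have hrec := partitionCount_succ (k + 1) r
      have e1 : k + 1 + 1 + r = r + (k + 1) + 1 := by ring
      have hc : (k + 1 + 1).choose 2 = (k + 1) + (k + 1).choose 2 := by
        rw [Nat.choose_succ_succ' (k + 1) 1, Nat.choose_one_right]
      have h1 := ih (r + (k + 1))
      have h2 := ihn r (by omega)
      have h3 := pow_add_mul_pow_le (r + (k + 1 + 1).choose 2) (k + 2) k
      have e2 : r + (k + 1) + (k + 1).choose 2 = r + (k + 1 + 1).choose 2 := by omega
      rw [e2] at h1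
      rw [e1, hrec]
      calc (k + 1 + 1).factorial * (k + 1).factorial *
            (partitionCount (k + 1) (r + (k + 1)) + partitionCount (k + 1 + 1) r)
          = (k + 1) * (k + 2) * ((k + 1).factorial * k.factorial *
              partitionCount (k + 1) (r + (k + 1))) +
            (k + 1 + 1).factorial * (k + 1).factorial * partitionCount (k + 1 + 1) r := by
            rw [Nat.factorial_succ (k + 1), Nat.factorial_succ k]; ring
        _ ≤ (k + 1) * (k + 2) * (r + (k + 1 + 1).choose 2) ^ k +
            (r + (k + 1 + 1).choose 2) ^ (k + 1) := by gcongr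
        _ ≤ (r + (k + 1 + 1).choose 2 + (k + 2)) ^ (k + 1) := by linarith
        _ = _ := by congr 1; omega

theorem le_factorial_mul_partitionCount (k n : ℕ) (hn : 0 < n) :
    (n - k) ^ k ≤ (k + 1).factorial * k.factorial * partitionCount (k + 1) n := by
  induction k generalizing n with
  | zero => simp [partitionCount_one hn]
  | succ k ih =>
    induction n using Nat.strong_induction_on with
    | _ n ihn =>
      rcases lt_or_ge n (k + 1 + 1) with h | h
      · rw [show n - (k + 1) = 0 by omega]
        simp
      obtain ⟨r, rfl⟩ := Nat.exists_eq_add_of_le h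
      have hrec := partitionCount_succ (k + 1) r
      have e1 : k + 1 + 1 + r = r + (k + 1) + 1 := by ring
      have h1 := ih (r + (k + 1)) (by omega)
      have h2 : (r - (k + 1)) ^ (k + 1) ≤
          (k + 1 + 1).factorial * (k + 1).factorial * partitionCount (k + 1 + 1) r := by
        rcases Nat.eq_zero_or_pos r with rfl | hr
        · simp
        · exact ihn r (by omega) hr
      rw [show r + (k + 1) - k = r + 1 by omega] at h1
      rw [e1, hrec, show r + (k + 1) + 1 - (k + 1) = r + 1 by omega]
      have h3 : (r + 1) ^ (k + 1) ≤ (r - (k + 1)) ^ (k + 1) + (k + 1) * (k + 2) * (r + 1) ^ k := by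
        rcases le_or_gt (k + 1) r with hr | hr
        · obtain ⟨s, rfl⟩ := Nat.exists_eq_add_of_le' hr
          have := pow_le_pow_add_mul s (k + 2) k
          simpa [add_assoc] using this
        · calc (r + 1) ^ (k + 1) = (r + 1) ^ k * (r + 1) := pow_succ _ _
            _ ≤ (r + 1) ^ k * ((k + 1) * (k + 2)) := by gcongr; nlinarith
            _ ≤ _ := by rw [mul_comm]; exact Nat.le_add_left _ _
      calc (r + 1) ^ (k + 1)
          ≤ (k + 1) * (k + 2) * (r + 1) ^ k + (r - (k + 1)) ^ (k + 1) := by linarith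
        _ ≤ (k + 1) * (k + 2) * ((k + 1).factorial * k.factorial *
              partitionCount (k + 1) (r + (k + 1))) +
            (k + 1 + 1).factorial * (k + 1).factorial * partitionCount (k + 1 + 1) r := by gcongr
        _ = _ := by rw [Nat.factorial_succ (k + 1), Nat.factorial_succ k]; ring

/-- A bounded change of the base does not affect the leading behaviour of a power. -/
theorem tendsto_shift_div_pow {u : ℕ → ℕ} {c : ℕ} (hu : ∀ n, n ≤ u n + c) (hu' : ∀ n, u n ≤ n + c)
    (j : ℕ) : Tendsto (fun n => (u n : ℝ) ^ j / (n : ℝ) ^ j) atTop (𝓝 1) := by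
  have h1 : Tendsto (fun n : ℕ => (u n : ℝ) / n) atTop (𝓝 1) := by
    have hc : Tendsto (fun n : ℕ => (c : ℝ) / n) atTop (𝓝 0) :=
      tendsto_const_div_atTop_nhds_zero_nat _
    refine tendsto_of_tendsto_of_tendsto_of_le_of_le' (g := fun n : ℕ => 1 - (c : ℝ) / n)
      (h := fun n : ℕ => 1 + (c : ℝ) / n) (by simpa using hc.const_sub 1)
      (by simpa using hc.const_add 1) ?_ ?_
    · filter_upwards [eventually_gt_atTop 0] with n hn
      have : (n : ℝ) ≤ u n + c := by exact_mod_cast hu n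
      have : (0 : ℝ) < n := by exact_mod_cast hn
      rw [le_div_iff₀ this, sub_mul, div_mul_cancel₀ _ this.ne']
      linarith
    · filter_upwards [eventually_gt_atTop 0] with n hn
      have : (u n : ℝ) ≤ n + c := by exact_mod_cast hu' n
      have : (0 : ℝ) < n := by exact_mod_cast hn
      rw [div_le_iff₀ this, add_mul, div_mul_cancel₀ _ this.ne']
      linarith
  simpa [div_pow] using h1.pow j

/-- `π(k, n) ∼ n^(k-1) / (k! (k-1)!)`. -/
theorem tendsto_partitionCount_div_pow (k : ℕ) :
    Tendsto (fun n => (partitionCount (k + 1) n : ℝ) / (n : ℝ) ^ k) atTop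
      (𝓝 (1 / ((k + 1).factorial * k.factorial : ℝ))) := by
  have hpos : (0 : ℝ) < (k + 1).factorial * k.factorial := by positivity
  have hlow := (tendsto_shift_div_pow (u := fun n => n - k) (c := k) (fun n => by omega)
    (fun n => by omega) k).div_const ((k + 1).factorial * k.factorial : ℝ)
  have hupp := (tendsto_shift_div_pow (u := fun n => n + (k + 1).choose 2) (c := (k + 1).choose 2)
    (fun n => by omega) (fun n => le_rfl) k).div_const ((k + 1).factorial * k.factorial : ℝ)
  refine tendsto_of_tendsto_of_tendsto_of_le_of_le' hlow hupp ?_ ?_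
  · filter_upwards [eventually_gt_atTop 0] with n hn
    have h : (((n - k : ℕ) : ℝ)) ^ k ≤
        (k + 1).factorial * k.factorial * partitionCount (k + 1) n := by
      exact_mod_cast le_factorial_mul_partitionCount k n hn
    rw [div_right_comm]
    gcongr
    rw [div_le_iff₀' hpos]
    exact h
  · filter_upwards with n
    have h : ((k + 1).factorial * k.factorial * partitionCount (k + 1) n : ℝ) ≤
        ((n + (k + 1).choose 2 : ℕ) : ℝ) ^ k := by
      exact_mod_cast factorial_mul_partitionCount_le k n
    rw [div_right_comm]
    gcongr
    rw [le_div_iff₀' hpos]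
    exact h

end Partitions

/-! ### Asymptotics of sums -/

section Sums

theorem tendsto_sum_pow_atTop (j : ℕ) :
    Tendsto (fun N => ∑ n ∈ Finset.range N, ((n : ℝ)) ^ j) atTop atTop := by
  refine (tendsto_atTop_mono' atTop (f₁ := fun N : ℕ => (N : ℝ) - 1) ?_
    (tendsto_atTop_add_const_right _ _ tendsto_natCast_atTop_atTop))
  filter_upwards [eventually_gt_atTop 0] with N hN
  obtain ⟨N, rfl⟩ := Nat.exists_eq_succ_of_ne_zero hN.ne'
  rw [Finset.sum_range_succ']
  have : ∑ n ∈ Finset.range N, (1 : ℝ) ≤ ∑ n ∈ Finset.range N, (((n + 1 : ℕ) : ℝ)) ^ j :=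
    Finset.sum_le_sum fun n _ => one_le_pow₀ (by push_cast; linarith [n.cast_nonneg (α := ℝ)])
  simp only [Finset.sum_const, Finset.card_range, nsmul_eq_mul, mul_one] at this
  have h0 : (0 : ℝ) ≤ ((0 : ℕ) : ℝ) ^ j := by positivity
  push_cast at *
  linarith

/-- If `a n ∼ c n^j`, then the partial sums of `a` are those of `c n^j` up to a relative error that
tends to `0`. -/
theorem isLittleO_sum_of_tendsto {a : ℕ → ℝ} {j : ℕ} {c : ℝ}
    (h : Tendsto (fun n => a n / (n : ℝ) ^ j) atTop (𝓝 c)) :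
    (fun N => ∑ n ∈ Finset.range N, (a n - c * (n : ℝ) ^ j)) =o[atTop]
      fun N => ∑ n ∈ Finset.range N, (n : ℝ) ^ j := by
  refine Asymptotics.IsLittleO.sum_range ?_ (fun n => by positivity) (tendsto_sum_pow_atTop j)
  rw [Asymptotics.isLittleO_iff_tendsto']
  · have h' := h.sub_const c
    rw [sub_self] at h'
    refine h'.congr' ?_
    filter_upwards [eventually_gt_atTop 0] with n hn
    have : (n : ℝ) ^ j ≠ 0 := by positivity
    field_simp
  · filter_upwards [eventually_gt_atTop 0] with n hn h0
    have : (n : ℝ) ^ j ≠ 0 := by positivity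
    exact absurd h0 this

theorem tendsto_sum_pow_div_pow (j : ℕ) :
    Tendsto (fun N : ℕ => (∑ n ∈ Finset.range N, (n : ℝ) ^ j) / (N : ℝ) ^ (j + 1)) atTop
      (𝓝 (1 / ((j : ℝ) + 1))) := by
  -- The telescoping sequence `(n+1)^(j+1) - n^(j+1)` is asymptotic to `(j+1) n^j`.
  have hdiff : Tendsto (fun n : ℕ => (((n + 1 : ℕ) : ℝ) ^ (j + 1) - (n : ℝ) ^ (j + 1)) /
      (n : ℝ) ^ j) atTop (𝓝 ((j : ℝ) + 1)) := by
    have hup := (tendsto_shift_div_pow (u := fun n => n + 1) (c := 1) (fun n => by omega)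
      (fun n => le_rfl) j).const_mul ((j : ℝ) + 1)
    rw [mul_one] at hup
    refine tendsto_of_tendsto_of_tendsto_of_le_of_le' tendsto_const_nhds hup ?_ ?_
    · filter_upwards [eventually_gt_atTop 0] with n hn
      have h : ((n : ℝ)) ^ (j + 1) + (j + 1) * 1 * (n : ℝ) ^ j ≤ ((n + 1 : ℕ) : ℝ) ^ (j + 1) := by
        exact_mod_cast pow_add_mul_pow_le n 1 j
      rw [le_div_iff₀ (by positivity)]
      linarith
    · filter_upwards [eventually_gt_atTop 0] with n hn
      have h : ((n + 1 : ℕ) : ℝ) ^ (j + 1) ≤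
          (n : ℝ) ^ (j + 1) + (j + 1) * 1 * ((n + 1 : ℕ) : ℝ) ^ j := by
        exact_mod_cast pow_le_pow_add_mul n 1 j
      rw [← mul_div_assoc]
      gcongr
      linarith
  have h := (isLittleO_sum_of_tendsto hdiff).tendsto_div_nhds_zero
  have h2 : Tendsto (fun N : ℕ => (N : ℝ) ^ (j + 1) / ∑ n ∈ Finset.range N, (n : ℝ) ^ j) atTop
      (𝓝 ((j : ℝ) + 1)) := by
    have h3 := h.add_const ((j : ℝ) + 1)
    rw [zero_add] at h3
    refine h3.congr' ?_
    filter_upwards [(tendsto_sum_pow_atTop j).eventually_gt_atTop 0] with N hN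
    rw [Finset.sum_sub_distrib, Finset.sum_range_sub fun n : ℕ => (n : ℝ) ^ (j + 1),
      ← Finset.mul_sum]
    field_simp
    simp
  have h4 := h2.inv₀ (by positivity)
  simpa [inv_div] using h4

theorem tendsto_sum_div_pow {a : ℕ → ℝ} {j : ℕ} {c : ℝ}
    (h : Tendsto (fun n => a n / (n : ℝ) ^ j) atTop (𝓝 c)) :
    Tendsto (fun N : ℕ => (∑ n ∈ Finset.range (N + 1), a n) / (N : ℝ) ^ (j + 1)) atTop
      (𝓝 (c / ((j : ℝ) + 1))) := by
  have h1 := (isLittleO_sum_of_tendsto h).tendsto_div_nhds_zero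
  have h2 := (h1.add_const c).mul (tendsto_sum_pow_div_pow j)
  have h3 : Tendsto (fun N : ℕ => (∑ n ∈ Finset.range N, a n) / (N : ℝ) ^ (j + 1)) atTop
      (𝓝 (c / ((j : ℝ) + 1))) := by
    rw [zero_add, mul_one_div] at h2
    refine h2.congr' ?_
    filter_upwards [(tendsto_sum_pow_atTop j).eventually_gt_atTop 0] with N hN
    rw [Finset.sum_sub_distrib, ← Finset.mul_sum]
    field_simp
    ring
  -- Pass from `∑_{n<N}` to `∑_{n≤N}`: the last term is `O(N^j)`.
  have h4 : Tendsto (fun N : ℕ => a N / (N : ℝ) ^ j * (1 / (N : ℝ))) atTop (𝓝 0) := by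
    simpa using h.mul (tendsto_one_div_atTop_nhds_zero_nat (𝕜 := ℝ))
  have h5 := h3.add h4
  rw [add_zero] at h5
  refine h5.congr fun N => ?_
  rw [Finset.sum_range_succ, add_div, pow_succ]
  simp only [div_eq_mul_inv, mul_inv]
  ring

/-- `∑_{n ≤ N} π(k, n) ∼ N^k / (k!)^2`. -/
theorem tendsto_sum_partitionCount (k : ℕ) :
    Tendsto (fun N : ℕ => (∑ n ∈ Finset.range (N + 1), (partitionCount (k + 1) n : ℝ)) /
      (N : ℝ) ^ (k + 1)) atTop (𝓝 (1 / ((k + 1).factorial : ℝ) ^ 2)) := by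
  have h := tendsto_sum_div_pow (tendsto_partitionCount_div_pow k)
  convert h using 2
  rw [Nat.factorial_succ]
  push_cast
  field_simp

theorem tendsto_sum_partitionCount_mul (p q : ℕ) :
    Tendsto (fun N : ℕ => (∑ n ∈ Finset.range (N + 1),
      (partitionCount (p + 1) n * partitionCount (q + 1) n : ℝ)) / (N : ℝ) ^ (p + q + 1)) atTop
      (𝓝 (1 / ((p + 1).factorial * p.factorial * ((q + 1).factorial * q.factorial) *
        ((p : ℝ) + q + 1)))) := by
  have h := tendsto_sum_div_pow (a := fun n => partitionCount (p + 1) n * partitionCount (q + 1) n)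
    (j := p + q) (((tendsto_partitionCount_div_pow p).mul
      (tendsto_partitionCount_div_pow q)).congr fun n => by rw [pow_add, div_mul_div_comm])
  convert h using 2
  push_cast
  field_simp

end Sums

/-! ### Counting the nodes for the torus -/

section TorusCount

/-- The torus multi-index with `z` zero entries, positive entries `s` and negative entries `-t`. -/
def signedIndex (z : ℕ) (s t : Multiset ℕ) : Multiset ℤ :=
  Multiset.replicate z 0 + s.map (fun n : ℕ => (n : ℤ)) + t.map (fun n : ℕ => -(n : ℤ))

theorem exists_signedIndex (k : Multiset ℤ) :
    ∃ z s t, (∀ a ∈ s, 0 < a) ∧ (∀ a ∈ t, 0 < a) ∧ signedIndex z s t = k := by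
  induction k using Multiset.induction with
  | empty => exact ⟨0, 0, 0, by simp, by simp, by simp [signedIndex]⟩
  | cons a k ih =>
    obtain ⟨z, s, t, hs, ht, rfl⟩ := ih
    rcases lt_trichotomy a 0 with ha | rfl | ha
    · refine ⟨z, s, a.natAbs ::ₘ t, hs, ?_, ?_⟩
      · intro b hb
        rcases Multiset.mem_cons.1 hb with rfl | hb
        · omega
        · exact ht b hb
      · rw [signedIndex, Multiset.map_cons, Multiset.add_cons, signedIndex,
          show -(a.natAbs : ℤ) = a by omega]
    · exact ⟨z + 1, s, t, hs, ht, by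
        simp [signedIndex, Multiset.replicate_succ, Multiset.cons_add]⟩
    · refine ⟨z, a.natAbs ::ₘ s, t, ?_, ht, ?_⟩
      · intro b hb
        rcases Multiset.mem_cons.1 hb with rfl | hb
        · omega
        · exact hs b hb
      · rw [signedIndex, Multiset.map_cons, Multiset.add_cons, Multiset.cons_add, signedIndex,
          show (a.natAbs : ℤ) = a by omega]

theorem card_signedIndex (z : ℕ) (s t : Multiset ℕ) :
    Multiset.card (signedIndex z s t) = z + Multiset.card s + Multiset.card t := by
  simp [signedIndex]

theorem sum_signedIndex (z : ℕ) (s t : Multiset ℕ) :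
    (signedIndex z s t).sum = (s.sum : ℤ) - t.sum := by
  have h1 : (s.map (fun n : ℕ => (n : ℤ))).sum = s.sum := by
    simp
  have h2 : (t.map (fun n : ℕ => -(n : ℤ))).sum = -t.sum := by
    simp
  simp only [signedIndex, Multiset.sum_add, Multiset.sum_replicate, h1, h2]
  simp [sub_eq_add_neg]

theorem totalDeg_signedIndex (z : ℕ) (s t : Multiset ℕ) :
    torus.totalDeg (signedIndex z s t) = s.sum + t.sum := by
  have h1 : torus.totalDeg (Multiset.replicate z 0) = 0 := by
    simp [SymmetryData.totalDeg, torus]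
  have h2 : torus.totalDeg (s.map (fun n : ℕ => (n : ℤ))) = s.sum := by
    simp [SymmetryData.totalDeg, torus, Multiset.map_map]
  have h3 : torus.totalDeg (t.map (fun n : ℕ => -(n : ℤ))) = t.sum := by
    simp [SymmetryData.totalDeg, torus, Multiset.map_map]
  rw [signedIndex, torus_totalDeg_add, torus_totalDeg_add, h1, h2, h3, zero_add]

theorem filter_pos_signedIndex {z : ℕ} {s t : Multiset ℕ} (hs : ∀ a ∈ s, 0 < a) :
    (signedIndex z s t).filter (0 < ·) = s.map (fun n : ℕ => (n : ℤ)) := by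
  rw [signedIndex, Multiset.filter_add, Multiset.filter_add]
  rw [Multiset.filter_eq_nil.2, Multiset.filter_eq_self.2, Multiset.filter_eq_nil.2]
  · simp
  · intro a ha
    obtain ⟨b, -, rfl⟩ := Multiset.mem_map.1 ha
    omega
  · intro a ha
    obtain ⟨b, hb, rfl⟩ := Multiset.mem_map.1 ha
    exact_mod_cast hs b hb
  · intro a ha
    rw [Multiset.eq_of_mem_replicate ha]
    exact lt_irrefl 0

theorem filter_neg_signedIndex {z : ℕ} {s t : Multiset ℕ} (ht : ∀ a ∈ t, 0 < a) :
    (signedIndex z s t).filter (· < 0) = t.map (fun n : ℕ => -(n : ℤ)) := by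
  rw [signedIndex, Multiset.filter_add, Multiset.filter_add]
  rw [Multiset.filter_eq_nil.2, Multiset.filter_eq_nil.2, Multiset.filter_eq_self.2]
  · simp
  · intro a ha
    obtain ⟨b, hb, rfl⟩ := Multiset.mem_map.1 ha
    have := ht b hb
    omega
  · intro a ha
    obtain ⟨b, -, rfl⟩ := Multiset.mem_map.1 ha
    omega
  · intro a ha
    rw [Multiset.eq_of_mem_replicate ha]
    exact lt_irrefl 0

theorem signedIndex_inj {z z' : ℕ} {s s' t t' : Multiset ℕ} (hs : ∀ a ∈ s, 0 < a)
    (ht : ∀ a ∈ t, 0 < a) (hs' : ∀ a ∈ s', 0 < a) (ht' : ∀ a ∈ t', 0 < a)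
    (h : signedIndex z s t = signedIndex z' s' t') : z = z' ∧ s = s' ∧ t = t' := by
  have h1 := congrArg (Multiset.filter (0 < ·)) h
  rw [filter_pos_signedIndex hs, filter_pos_signedIndex hs'] at h1
  have h1' := Multiset.map_injective (fun (a b : ℕ) (hab : (a : ℤ) = b) => by exact_mod_cast hab) h1
  have h2 := congrArg (Multiset.filter (· < 0)) h
  rw [filter_neg_signedIndex ht, filter_neg_signedIndex ht'] at h2
  have h2' := Multiset.map_injective
    (fun (a b : ℕ) (hab : -(a : ℤ) = -(b : ℤ)) => by exact_mod_cast neg_injective hab) h2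
  have h3 := congrArg Multiset.card h
  rw [card_signedIndex, card_signedIndex, h1', h2'] at h3
  exact ⟨by omega, h1', h2'⟩

/-- The partitions with `2, …, ν - 1` parts of a number in `1, …, D / 2`. -/
def auxParts (ν D : ℕ) : Finset (Multiset ℕ) :=
  (Finset.Icc 2 (ν - 1) ×ˢ Finset.Icc 1 (D / 2)).biUnion fun x => partsFinset x.1 x.2

theorem mem_auxParts {ν D : ℕ} {s : Multiset ℕ} : s ∈ auxParts ν D ↔ (∀ a ∈ s, 0 < a) ∧
    2 ≤ Multiset.card s ∧ Multiset.card s ≤ ν - 1 ∧ 2 * s.sum ≤ D := by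
  simp only [auxParts, Finset.mem_biUnion, Finset.mem_product, Finset.mem_Icc, mem_partsFinset,
    Prod.exists]
  constructor
  · rintro ⟨k, n, ⟨hk, hn⟩, rfl, rfl, hpos⟩
    exact ⟨hpos, hk.1, hk.2, by omega⟩
  · rintro ⟨hpos, h2, hν, hD⟩
    have := le_sum_of_forall_pos hpos
    exact ⟨_, _, ⟨⟨h2, hν⟩, by omega, by omega⟩, rfl, rfl, hpos⟩

theorem card_auxParts (ν D : ℕ) : (auxParts ν D).card =
    ∑ k ∈ Finset.Icc 2 (ν - 1), ∑ n ∈ Finset.Icc 1 (D / 2), partitionCount k n := by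
  rw [auxParts, Finset.card_biUnion, Finset.sum_product]
  · simp only [card_partsFinset]
  · intro x _ y _ hxy
    rw [Function.onFun, Finset.disjoint_left]
    intro s hs hs'
    rw [mem_partsFinset] at hs hs'
    exact hxy (Prod.ext (hs.1.symm.trans hs'.1) (hs.2.1.symm.trans hs'.2.1))

theorem torus_auxNodes_eq_image {ν D : ℕ} {𝒢 : CompGraph ℤ} (h : torus.IsOutput ν D 𝒢) :
    torus.auxNodes 𝒢 = ↑((auxParts ν D).image (fun s => signedIndex 0 s 0) ∪
      (auxParts ν D).image (fun s => signedIndex 0 0 s)) := by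
  rw [torus_auxNodes_eq h]
  ext q
  simp only [Finset.coe_union, Finset.coe_image, Set.mem_union, Set.mem_image, Finset.mem_coe,
    mem_auxParts, Set.mem_ofPred_eq]
  constructor
  · rintro ⟨hq, h2, hν, hD⟩
    obtain ⟨z, s, t, hs, ht, rfl⟩ := exists_signedIndex q
    have hz : z = 0 := by
      by_contra hz
      exact hq.ne_zero_of_mem (a := 0) (by simp [signedIndex, Multiset.mem_replicate, hz]) rfl
    subst hz
    rw [card_signedIndex] at h2 hν
    rw [totalDeg_signedIndex] at hD
    rcases hq with hq | hq
    · have ht0 : t = 0 := by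
        refine Multiset.eq_zero_of_forall_notMem fun a ha => ?_
        have := hq (-(a : ℤ)) (by simp [signedIndex, ha])
        omega
      subst ht0
      simp only [Multiset.card_zero, Multiset.sum_zero] at *
      exact Or.inl ⟨s, ⟨hs, by omega, by omega, by omega⟩, rfl⟩
    · have hs0 : s = 0 := by
        refine Multiset.eq_zero_of_forall_notMem fun a ha => ?_
        have := hq (a : ℤ) (by simp [signedIndex, ha])
        omega
      subst hs0
      simp only [Multiset.card_zero, Multiset.sum_zero] at *
      exact Or.inr ⟨t, ⟨ht, by omega, by omega, by omega⟩, rfl⟩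
  · rintro (⟨s, ⟨hs, h2, hν, hD⟩, rfl⟩ | ⟨s, ⟨hs, h2, hν, hD⟩, rfl⟩) <;>
      rw [card_signedIndex, totalDeg_signedIndex]
    · refine ⟨Or.inl fun a ha => ?_, by simpa using h2, by simpa using hν, by simpa using hD⟩
      simp only [signedIndex, Multiset.replicate_zero, zero_add, Multiset.map_zero, add_zero,
        Multiset.mem_map] at ha
      obtain ⟨b, hb, rfl⟩ := ha
      exact_mod_cast hs b hb
    · refine ⟨Or.inr fun a ha => ?_, by simpa using h2, by simpa using hν, by simpa using hD⟩
      simp only [signedIndex, Multiset.replicate_zero, zero_add, Multiset.map_zero,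
        Multiset.mem_map] at ha
      obtain ⟨b, hb, rfl⟩ := ha
      have := hs b hb
      omega

theorem torus_ncard_auxNodes {ν D : ℕ} {𝒢 : CompGraph ℤ} (h : torus.IsOutput ν D 𝒢) :
    (torus.auxNodes 𝒢).ncard =
      2 * ∑ k ∈ Finset.Icc 2 (ν - 1), ∑ n ∈ Finset.Icc 1 (D / 2), partitionCount k n := by
  rw [torus_auxNodes_eq_image h, Set.ncard_coe_finset, Finset.card_union_of_disjoint,
    Finset.card_image_of_injOn, Finset.card_image_of_injOn, card_auxParts, two_mul]
  · intro s hs t ht hst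
    exact (signedIndex_inj (by simp) (mem_auxParts.1 hs).1 (by simp) (mem_auxParts.1 ht).1 hst).2.2
  · intro s hs t ht hst
    exact (signedIndex_inj (mem_auxParts.1 hs).1 (by simp) (mem_auxParts.1 ht).1 (by simp) hst).2.1
  · rw [Finset.disjoint_left]
    rintro q hq hq'
    obtain ⟨s, hs, rfl⟩ := Finset.mem_image.1 hq
    obtain ⟨t, ht, hst⟩ := Finset.mem_image.1 hq'
    have h0 := (signedIndex_inj (by simp) (mem_auxParts.1 ht).1 (mem_auxParts.1 hs).1
      (by simp) hst).2.1
    have := (mem_auxParts.1 hs).2.1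
    simp [← h0] at this

/-- The possible numbers `(z, p, q)` of zero, positive and negative entries of a multi-index of
correlation order between `1` and `ν`. -/
def signCounts (ν : ℕ) : Finset (ℕ × ℕ × ℕ) :=
  (Finset.range (ν + 1) ×ˢ Finset.range (ν + 1) ×ˢ Finset.range (ν + 1)).filter
    fun x => 1 ≤ x.1 + x.2.1 + x.2.2 ∧ x.1 + x.2.1 + x.2.2 ≤ ν

theorem mem_signCounts {ν : ℕ} {x : ℕ × ℕ × ℕ} :
    x ∈ signCounts ν ↔ 1 ≤ x.1 + x.2.1 + x.2.2 ∧ x.1 + x.2.1 + x.2.2 ≤ ν := by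
  simp only [signCounts, Finset.mem_filter, Finset.mem_product, Finset.mem_range]
  omega

/-- The triples (number of zeros, positive entries, negated negative entries) that encode the
invariant multi-indices of degree at most `D` for the torus. -/
def basisParts (ν D : ℕ) : Finset (ℕ × Multiset ℕ × Multiset ℕ) :=
  (signCounts ν ×ˢ Finset.range (D / 2 + 1)).biUnion fun x =>
    {x.1.1} ×ˢ partsFinset x.1.2.1 x.2 ×ˢ partsFinset x.1.2.2 x.2

theorem mem_basisParts {ν D : ℕ} {y : ℕ × Multiset ℕ × Multiset ℕ} : y ∈ basisParts ν D ↔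
    (∀ a ∈ y.2.1, 0 < a) ∧ (∀ a ∈ y.2.2, 0 < a) ∧
    (1 ≤ y.1 + Multiset.card y.2.1 + Multiset.card y.2.2 ∧
      y.1 + Multiset.card y.2.1 + Multiset.card y.2.2 ≤ ν) ∧
    y.2.1.sum = y.2.2.sum ∧ 2 * y.2.1.sum ≤ D := by
  obtain ⟨z, s, t⟩ := y
  simp only [basisParts, Finset.mem_biUnion, Finset.mem_product, mem_signCounts, Finset.mem_range,
    mem_partsFinset, Finset.mem_singleton, Prod.exists]
  constructor
  · rintro ⟨z', p, q, n, ⟨h1, hn⟩, rfl, ⟨rfl, rfl, hs⟩, rfl, hts, ht⟩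
    exact ⟨hs, ht, h1, hts.symm, by omega⟩
  · rintro ⟨hs, ht, h1, hst, hD⟩
    exact ⟨z, _, _, _, ⟨h1, by omega⟩, rfl, ⟨rfl, rfl, hs⟩, rfl, hst.symm, ht⟩

theorem card_basisParts (ν D : ℕ) : (basisParts ν D).card =
    ∑ x ∈ signCounts ν, ∑ n ∈ Finset.range (D / 2 + 1),
      partitionCount x.2.1 n * partitionCount x.2.2 n := by
  rw [basisParts, Finset.card_biUnion, Finset.sum_product]
  · simp only [Finset.card_product, Finset.card_singleton, one_mul, card_partsFinset]
  · rintro ⟨⟨z, p, q⟩, n⟩ _ ⟨⟨z', p', q'⟩, n'⟩ _ hxy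
    rw [Function.onFun, Finset.disjoint_left]
    rintro ⟨w, s, t⟩ hs hs'
    simp only [Finset.mem_product, Finset.mem_singleton, mem_partsFinset] at hs hs'
    obtain ⟨rfl, ⟨rfl, rfl, -⟩, rfl, -⟩ := hs
    obtain ⟨rfl, ⟨rfl, rfl, -⟩, rfl, -⟩ := hs'
    exact hxy rfl

theorem torus_iUnion_basisSet_eq (ν D : ℕ) : (⋃ μ ∈ Finset.Icc 1 ν, torus.basisSet μ D) =
    ↑((basisParts ν D).image fun y => signedIndex y.1 y.2.1 y.2.2) := by
  ext k
  simp only [Set.mem_iUnion, Finset.coe_image, Set.mem_image, Finset.mem_coe, Prod.exists,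
    mem_basisParts, Finset.mem_Icc, exists_prop]
  constructor
  · rintro ⟨μ, hμ, ⟨-, hsum⟩, hdeg, hcard⟩
    obtain ⟨z, s, t, hs, ht, rfl⟩ := exists_signedIndex k
    rw [sum_signedIndex] at hsum
    rw [totalDeg_signedIndex] at hdeg
    rw [card_signedIndex] at hcard
    exact ⟨z, s, t, ⟨hs, ht, by omega, by omega, by omega⟩, rfl⟩
  · rintro ⟨z, s, t, ⟨hs, ht, hcard, hst, hD⟩, rfl⟩
    refine ⟨_, hcard, ⟨?_, ?_⟩, ?_, card_signedIndex z s t⟩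
    · rw [← Multiset.card_pos, card_signedIndex]
      exact hcard.1
    · rw [sum_signedIndex, hst, sub_self]
    · rw [totalDeg_signedIndex]
      omega

theorem torus_ncard_iUnion_basisSet (ν D : ℕ) :
    (⋃ μ ∈ Finset.Icc 1 ν, torus.basisSet μ D).ncard =
      ∑ x ∈ signCounts ν, ∑ n ∈ Finset.range (D / 2 + 1),
        partitionCount x.2.1 n * partitionCount x.2.2 n := by
  rw [torus_iUnion_basisSet_eq, Set.ncard_coe_finset, Finset.card_image_of_injOn, card_basisParts]
  rintro ⟨z, s, t⟩ h ⟨z', s', t'⟩ h' heq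
  obtain ⟨hs, ht, -⟩ := mem_basisParts.1 h
  obtain ⟨hs', ht', -⟩ := mem_basisParts.1 h'
  obtain ⟨rfl, rfl, rfl⟩ := signedIndex_inj hs ht hs' ht' heq
  rfl

theorem torus_finite_deg_le (D : ℕ) : {a | torus.deg a ≤ D}.Finite := by
  refine (Set.finite_Icc (-(D : ℤ)) D).subset fun a ha => ?_
  have : a.natAbs ≤ D := ha
  rw [Set.mem_Icc]
  omega

end TorusCount

/-! ### The limit ratio for the torus -/

section TorusLimit

/-- `#A_𝕋(ν, D)` is asymptotic to `2 (D/2)^(ν-1) / ((ν-1)!)^2`; here `ν = m + 1`, `N = ⌊D/2⌋`. -/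
theorem tendsto_aux_sum (m : ℕ) (hm : 2 ≤ m) :
    Tendsto (fun N : ℕ => ((2 * ∑ k ∈ Finset.Icc 2 m, ∑ n ∈ Finset.Icc 1 N, partitionCount k n : ℕ)
      : ℝ) / (N : ℝ) ^ m) atTop (𝓝 (2 / (m.factorial : ℝ) ^ 2)) := by
  have hterm : ∀ k ∈ Finset.Icc 2 m, Tendsto (fun N : ℕ =>
      (∑ n ∈ Finset.range (N + 1), (partitionCount k n : ℝ)) / (N : ℝ) ^ m) atTop
        (𝓝 (if k = m then 1 / (m.factorial : ℝ) ^ 2 else 0)) := by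
    intro k hk
    rw [Finset.mem_Icc] at hk
    obtain ⟨j, rfl⟩ := Nat.exists_eq_add_of_le' (show 1 ≤ k by omega)
    have h := tendsto_sum_partitionCount j
    split_ifs with hkm
    · rwa [← hkm]
    · obtain ⟨r, rfl⟩ := Nat.exists_eq_add_of_le hk.2
      have hr : r ≠ 0 := by omega
      have h0 : Tendsto (fun N : ℕ => ((1 : ℝ) / (N : ℝ)) ^ r) atTop (𝓝 0) := by
        simpa [hr] using (tendsto_one_div_atTop_nhds_zero_nat (𝕜 := ℝ)).pow r
      have h1 := h.mul h0
      rw [mul_zero] at h1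
      refine h1.congr fun N => ?_
      rw [one_div, inv_pow, pow_add _ (j + 1) r, div_mul_eq_div_div, ← div_eq_mul_inv]
  have hsum := (tendsto_finsetSum _ hterm).const_mul 2
  rw [Finset.sum_ite_eq' , if_pos (Finset.mem_Icc.2 ⟨hm, le_rfl⟩), mul_one_div] at hsum
  refine hsum.congr fun N => ?_
  rw [← Finset.sum_div, ← mul_div_assoc]
  push_cast
  congr 2
  refine Finset.sum_congr rfl fun k hk => ?_
  rw [Finset.mem_Icc] at hk
  -- The term `n = 0` vanishes.
  rw [Finset.range_eq_Ico, Finset.sum_eq_sum_Ico_succ_bot (by omega),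
    partitionCount_of_lt (by omega)]
  simp only [Nat.cast_zero, zero_add]
  rfl

/-- The leading coefficient of the number of invariant multi-indices with `p + 1` positive and
`q + 1` negative entries.  It is a Narayana number up to a factor that depends on
`p + q` only. -/
theorem leading_coeff_eq (p q : ℕ) :
    (1 : ℝ) / ((p + 1).factorial * p.factorial * ((q + 1).factorial * q.factorial) *
      ((p : ℝ) + q + 1)) =
    ((p + q + 1).choose (p + 1) * (p + q + 1).choose (q + 1) : ℝ) /
      (((p + q + 1 : ℕ) : ℝ) * ((p + q + 1).factorial : ℝ) ^ 2) := by
  have h1 : ((p + q + 1).choose (p + 1) : ℝ) * (p + 1).factorial * q.factorial =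
      (p + q + 1).factorial := by
    have := Nat.choose_mul_factorial_mul_factorial (show p + 1 ≤ p + q + 1 by omega)
    rw [show p + q + 1 - (p + 1) = q by omega] at this
    exact_mod_cast this
  have h2 : ((p + q + 1).choose (q + 1) : ℝ) * (q + 1).factorial * p.factorial =
      (p + q + 1).factorial := by
    have := Nat.choose_mul_factorial_mul_factorial (show q + 1 ≤ p + q + 1 by omega)
    rw [show p + q + 1 - (q + 1) = p by omega] at this
    exact_mod_cast this
  rw [div_eq_div_iff (by positivity) (by positivity), sq]
  nth_rewrite 1 [← h1]
  nth_rewrite 1 [← h2]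
  push_cast
  ring

theorem tendsto_basis_term (m : ℕ) (hm : 2 ≤ m) (z p q : ℕ) (h : z + p + q ≤ m + 1) :
    Tendsto (fun N : ℕ => (∑ n ∈ Finset.range (N + 1),
      (partitionCount p n * partitionCount q n : ℝ)) / (N : ℝ) ^ m) atTop
      (𝓝 (if p + q = m + 1 then
        (m.choose p * m.choose q : ℝ) / ((m : ℝ) * (m.factorial : ℝ) ^ 2) else 0)) := by
  -- Without positive or without negative entries there is at most the zero multi-index.
  have hzero : p = 0 ∨ q = 0 → Tendsto (fun N : ℕ => (∑ n ∈ Finset.range (N + 1),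
      (partitionCount p n * partitionCount q n : ℝ)) / (N : ℝ) ^ m) atTop (𝓝 0) := by
    intro hpq
    have : ∀ N : ℕ, ∑ n ∈ Finset.range (N + 1), (partitionCount p n * partitionCount q n : ℝ) =
        partitionCount p 0 * partitionCount q 0 := by
      intro N
      rw [Finset.sum_range_succ', Finset.sum_eq_zero, zero_add]
      intro n _
      rcases hpq with rfl | rfl <;> simp [partitionCount_zero_left]
    simp only [this]
    exact tendsto_const_nhds.div_atTop
      ((tendsto_pow_atTop (by omega)).comp tendsto_natCast_atTop_atTop)
  rcases Nat.eq_zero_or_pos p with rfl | hp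
  · convert hzero (Or.inl rfl) using 2
    rw [ite_eq_right_iff]
    intro hq
    rw [Nat.choose_eq_zero_of_lt (show m < q by omega)]
    simp
  rcases Nat.eq_zero_or_pos q with rfl | hq
  · convert hzero (Or.inr rfl) using 2
    rw [ite_eq_right_iff]
    intro hq
    rw [Nat.choose_eq_zero_of_lt (show m < p by omega)]
    simp
  obtain ⟨a, rfl⟩ := Nat.exists_eq_add_of_le' hp
  obtain ⟨b, rfl⟩ := Nat.exists_eq_add_of_le' hq
  have hlim := tendsto_sum_partitionCount_mul a b
  split_ifs with hpq
  · obtain rfl : m = a + b + 1 := by omega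
    rwa [leading_coeff_eq] at hlim
  · obtain ⟨r, rfl⟩ := Nat.exists_eq_add_of_le (show a + b + 1 ≤ m by omega)
    have hr : r ≠ 0 := by omega
    have h0 : Tendsto (fun N : ℕ => ((1 : ℝ) / (N : ℝ)) ^ r) atTop (𝓝 0) := by
      simpa [hr] using (tendsto_one_div_atTop_nhds_zero_nat (𝕜 := ℝ)).pow r
    have h1 := hlim.mul h0
    rw [mul_zero] at h1
    refine h1.congr fun N => ?_
    rw [one_div, inv_pow, pow_add _ (a + b + 1) r, div_mul_eq_div_div, ← div_eq_mul_inv]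

theorem mul_catalan_eq_choose (m : ℕ) (hm : 1 ≤ m) :
    m * catalan m = (2 * m).choose (m - 1) := by
  have h1 := succ_mul_catalan_eq_centralBinom m
  have h2 := Nat.choose_succ_right_eq (2 * m) (m - 1)
  rw [Nat.sub_add_cancel hm, show 2 * m - (m - 1) = m + 1 by omega] at h2
  rw [Nat.centralBinom_eq_two_mul_choose] at h1
  have : (m + 1) * (m * catalan m) = (m + 1) * (2 * m).choose (m - 1) := by
    calc (m + 1) * (m * catalan m) = (m + 1) * catalan m * m := by ring
      _ = _ := by rw [h1, h2, mul_comm]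
  exact Nat.eq_of_mul_eq_mul_left (by omega) this

/-- The Narayana numbers sum to a Catalan number, by Vandermonde's identity. -/
theorem sum_signCounts_choose (m : ℕ) (hm : 1 ≤ m) :
    ∑ x ∈ signCounts (m + 1), (if x.2.1 + x.2.2 = m + 1 then
      (m.choose x.2.1 * m.choose x.2.2 : ℕ) else 0) = m * catalan m := by
  rw [mul_catalan_eq_choose m hm, ← Nat.choose_symm (by omega),
    show 2 * m - (m - 1) = m + 1 by omega, two_mul, Nat.add_choose_eq, ← Finset.sum_filter]
  refine Finset.sum_nbij' (fun x => x.2) (fun y => (0, y)) ?_ ?_ ?_ ?_ ?_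
  · intro x hx
    rw [Finset.mem_filter] at hx
    exact Finset.HasAntidiagonal.mem_antidiagonal.2 hx.2
  · intro y hy
    rw [Finset.HasAntidiagonal.mem_antidiagonal] at hy
    simp only [Finset.mem_filter, mem_signCounts]
    omega
  · rintro ⟨z, p, q⟩ hx
    simp only [Finset.mem_filter, mem_signCounts] at hx
    simp only [Prod.mk.injEq, and_true]
    omega
  · intro y _
    rfl
  · intro x _
    rfl

theorem tendsto_basis_sum (m : ℕ) (hm : 2 ≤ m) :
    Tendsto (fun N : ℕ => ((∑ x ∈ signCounts (m + 1), ∑ n ∈ Finset.range (N + 1),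
      partitionCount x.2.1 n * partitionCount x.2.2 n : ℕ) : ℝ) / (N : ℝ) ^ m) atTop
      (𝓝 ((catalan m : ℝ) / (m.factorial : ℝ) ^ 2)) := by
  have h := tendsto_finsetSum (signCounts (m + 1)) fun x hx =>
    tendsto_basis_term m hm x.1 x.2.1 x.2.2 (mem_signCounts.1 hx).2
  have hval : ∑ x ∈ signCounts (m + 1), (if x.2.1 + x.2.2 = m + 1 then
      (m.choose x.2.1 * m.choose x.2.2 : ℝ) / ((m : ℝ) * (m.factorial : ℝ) ^ 2) else 0) =
      (catalan m : ℝ) / (m.factorial : ℝ) ^ 2 := by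
    have hc : ∑ x ∈ signCounts (m + 1), (if x.2.1 + x.2.2 = m + 1 then
      (m.choose x.2.1 * m.choose x.2.2 : ℝ) else 0) = m * catalan m := by
      exact_mod_cast sum_signCounts_choose m (by omega)
    have hm0 : (m : ℝ) ≠ 0 := by
      have : m ≠ 0 := by omega
      exact_mod_cast this
    calc _ = (∑ x ∈ signCounts (m + 1), (if x.2.1 + x.2.2 = m + 1 then
          (m.choose x.2.1 * m.choose x.2.2 : ℝ) else 0)) / ((m : ℝ) * (m.factorial : ℝ) ^ 2) := by
          rw [Finset.sum_div]
          exact Finset.sum_congr rfl fun x _ => by split_ifs <;> simp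
      _ = _ := by rw [hc, mul_div_mul_left _ _ hm0]
  rw [hval] at h
  refine h.congr fun N => ?_
  rw [← Finset.sum_div]
  push_cast
  rfl

theorem tendsto_torus_auxRatio (ν : ℕ) (hν : 3 ≤ ν) (𝒢 : ℕ → CompGraph ℤ)
    (h : ∀ D, torus.IsOutput ν D (𝒢 D)) :
    Tendsto (fun D => torus.auxRatio ν D (𝒢 D)) atTop
      (𝓝 (1 / (1 + (catalan (ν - 1) : ℝ) / 2))) := by
  obtain ⟨m, rfl⟩ := Nat.exists_eq_add_of_le' (show 1 ≤ ν by omega)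
  have hdiv : Tendsto (fun D : ℕ => D / 2) atTop atTop := Nat.tendsto_div_const_atTop (by norm_num)
  have hA := (tendsto_aux_sum m (by omega)).comp hdiv
  have hK := (tendsto_basis_sum m (by omega)).comp hdiv
  have hlim := hA.div (hA.add hK) (by positivity)
  have hval : (2 / (m.factorial : ℝ) ^ 2) / (2 / (m.factorial : ℝ) ^ 2 +
      (catalan m : ℝ) / (m.factorial : ℝ) ^ 2) = 1 / (1 + (catalan m : ℝ) / 2) := by
    field_simp
  rw [hval] at hlim
  rw [Nat.add_sub_cancel]
  refine hlim.congr' ?_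
  filter_upwards [eventually_ge_atTop 2] with D hD
  rw [SymmetryData.auxRatio, (h D).ncard_allNodes (torus_finite_deg_le D),
    torus_ncard_auxNodes (h D), torus_ncard_iUnion_basisSet, Nat.add_sub_cancel, Nat.cast_add]
  have hN : (((D / 2 : ℕ) : ℝ)) ^ m ≠ 0 := by
    have : D / 2 ≠ 0 := by omega
    positivity
  simp only [Pi.div_apply, Function.comp_apply]
  rw [← add_div, div_div_div_cancel_right₀ hN]

end TorusLimit

/-! ### Ratio bounds from dimension counts -/

section Ratio

variable {κ : Type} {S : SymmetryData κ}

/-- If the one-particle indices of degree `≤ D` form an `e`-dimensional family, and the invariant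
multi-indices of order `ν` a family of dimension `e ν - 1`, then the auxiliary nodes, of order
`≤ ν - 1`, form a negligible part of codimension `e - 1`. -/
theorem SymmetryData.IsOutput.auxRatio_le {ν D e c t : ℕ} {𝒢 : CompGraph κ}
    (h : S.IsOutput ν D 𝒢) (hν : 1 ≤ ν) (he : 1 ≤ e) (ht : 0 < t) (hD : t ≤ D)
    (hfin : {a | S.deg a ≤ D}.Finite) (hcard : {a | S.deg a ≤ D}.ncard + 1 ≤ c * D ^ e)
    (hlow : (D / t) ^ (e * ν - 1) ≤ (S.basisSet ν D).ncard) :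
    S.auxRatio ν D 𝒢 ≤ ((c ^ (ν - 1) * (2 * t) ^ (e * ν - 1) : ℕ) : ℝ) *
      (1 / (D : ℝ) ^ (e - 1)) := by
  have hDpos : 0 < D := by omega
  have hM : 1 ≤ D / t := (Nat.one_le_div_iff ht).2 hD
  have hA : (S.auxNodes 𝒢).ncard ≤ (c * D ^ e) ^ (ν - 1) :=
    (Set.ncard_le_ncard h.auxNodes_subset (S.finite_boundedIndices _ D hfin)).trans
      ((S.ncard_boundedIndices_le _ D hfin).trans (Nat.pow_le_pow_left hcard _))
  have hV : (D / t) ^ (e * ν - 1) ≤ (S.allNodes ν D 𝒢).ncard := by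
    refine hlow.trans (Set.ncard_le_ncard ?_
      ((h.finite_auxNodes hfin).union (S.finite_iUnion_basisSet ν D hfin)))
    refine subset_trans ?_ Set.subset_union_right
    exact Set.subset_biUnion_of_mem (u := fun μ => S.basisSet μ D)
      (show ν ∈ (Finset.Icc 1 ν : Finset ℕ) from Finset.mem_Icc.2 ⟨hν, le_rfl⟩)
  have hDM : D ≤ 2 * t * (D / t) := by
    have h1 := Nat.div_add_mod D t
    have h2 := Nat.mod_lt D ht
    nlinarith
  have hexp : e * (ν - 1) + (e - 1) = e * ν - 1 := by
    obtain ⟨m, rfl⟩ := Nat.exists_eq_add_of_le' hν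
    rw [Nat.add_sub_cancel, mul_add, mul_one]
    omega
  have key : (S.auxNodes 𝒢).ncard * D ^ (e - 1) ≤
      c ^ (ν - 1) * (2 * t) ^ (e * ν - 1) * (S.allNodes ν D 𝒢).ncard := by
    calc (S.auxNodes 𝒢).ncard * D ^ (e - 1) ≤ (c * D ^ e) ^ (ν - 1) * D ^ (e - 1) := by gcongr
      _ = c ^ (ν - 1) * D ^ (e * ν - 1) := by
        rw [mul_pow, ← pow_mul, mul_assoc, ← pow_add, hexp]
      _ ≤ c ^ (ν - 1) * (2 * t * (D / t)) ^ (e * ν - 1) := by gcongr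
      _ = c ^ (ν - 1) * (2 * t) ^ (e * ν - 1) * (D / t) ^ (e * ν - 1) := by
        rw [mul_pow (2 * t), mul_assoc]
      _ ≤ _ := by gcongr
  have hVpos : 0 < (S.allNodes ν D 𝒢).ncard := lt_of_lt_of_le (by positivity) hV
  rw [SymmetryData.auxRatio, mul_one_div, div_le_div_iff₀ (by exact_mod_cast hVpos) (by positivity)]
  exact_mod_cast key

/-- A tuple whose entries carry their positions as tags is determined by its multiset of
entries. -/
theorem eq_of_map_univ_eq {n : ℕ} {f g : Fin n → κ} (tag : κ → ℕ) (hf : ∀ i, tag (f i) = i)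
    (hg : ∀ i, tag (g i) = i) (h : Finset.univ.val.map f = Finset.univ.val.map g) : f = g := by
  funext i
  have hi : f i ∈ Finset.univ.val.map g := by
    rw [← h]
    exact Multiset.mem_map_of_mem f (Finset.mem_univ i)
  obtain ⟨j, -, hj⟩ := Multiset.mem_map.1 hi
  have : j = i := by
    rw [Fin.ext_iff, ← hg j, hj, hf i]
  rw [← hj, this]

/-- Lower bound for the number of invariant multi-indices from a family of tagged tuples. -/
theorem card_le_ncard_basisSet {ν D : ℕ} {P : Type} [Fintype P] (F : P → Fin ν → κ)
    (hF : Function.Injective F) (tag : κ → ℕ) (htag : ∀ p i, tag (F p i) = i)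
    (hmem : ∀ p, Finset.univ.val.map (F p) ∈ S.basisSet ν D) (hfin : {a | S.deg a ≤ D}.Finite) :
    Fintype.card P ≤ (S.basisSet ν D).ncard := by
  have hinj : Function.Injective fun p => Finset.univ.val.map (F p) := fun p q hpq =>
    hF (eq_of_map_univ_eq tag (htag p) (htag q) hpq)
  rw [← Nat.card_eq_fintype_card, ← Set.ncard_univ, ← Set.ncard_image_of_injective _ hinj]
  refine Set.ncard_le_ncard ?_ ((S.finite_boundedIndices ν D hfin).subset (S.basisSet_subset le_rfl))
  rintro _ ⟨p, -, rfl⟩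
  exact hmem p

theorem totalDeg_map_univ_le {ν B : ℕ} (f : Fin ν → κ) (h : ∀ i, S.deg (f i) ≤ B) :
    S.totalDeg (Finset.univ.val.map f) ≤ ν * B := by
  rw [SymmetryData.totalDeg, Multiset.map_map]
  calc _ = ∑ i, S.deg (f i) := rfl
    _ ≤ ∑ _i : Fin ν, B := Finset.sum_le_sum fun i _ => h i
    _ = ν * B := by simp

theorem sum_fin_val_le {m M : ℕ} (y : Fin m → Fin M) : ∑ j, (y j : ℕ) ≤ m * M := by
  calc ∑ j, (y j : ℕ) ≤ ∑ _j : Fin m, M := Finset.sum_le_sum fun j _ => (y j).2.le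
    _ = m * M := by simp

theorem mul_add_div_of_lt {M i x : ℕ} (hx : x < M) : (i * M + x) / M = i := by
  rw [mul_comm, Nat.mul_add_div (by omega), Nat.div_eq_of_lt hx, add_zero]

theorem mul_add_le_of_lt {m M i x : ℕ} (hi : i < m) (hx : x < M) : i * M + x ≤ m * M := by
  calc i * M + x ≤ i * M + M := by omega
    _ = (i + 1) * M := by ring
    _ ≤ m * M := Nat.mul_le_mul_right _ hi

end Ratio

/-! ### The group `SO(2)` -/

section SO2

theorem so2_deg_le_subset (D : ℕ) : {a | so2.deg a ≤ D} ⊆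
    ↑(Finset.range (D + 1) ×ˢ Finset.Icc (-(D : ℤ)) D) := by
  rintro ⟨n, m⟩ h
  have h' : n + m.natAbs ≤ D := h
  simp only [Finset.coe_product, Set.mem_prod, Finset.mem_coe, Finset.mem_range, Finset.mem_Icc]
  omega

theorem so2_finite_deg_le (D : ℕ) : {a | so2.deg a ≤ D}.Finite :=
  (Finset.finite_toSet _).subset (so2_deg_le_subset D)

theorem so2_ncard_deg_le {D : ℕ} (hD : 1 ≤ D) : {a | so2.deg a ≤ D}.ncard + 1 ≤ 7 * D ^ 2 := by
  have h := Set.ncard_le_ncard (so2_deg_le_subset D) (Finset.finite_toSet _)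
  rw [Set.ncard_coe_finset, Finset.card_product, Finset.card_range, Int.card_Icc,
    show ((D : ℤ) + 1 - -(D : ℤ)).toNat = 2 * D + 1 by omega] at h
  nlinarith

/-- Tuples of one-particle indices of `SO(2)`: the radial indices lie in the blocks
`[i M, (i + 1) M)`, and the last angular index makes the tuple invariant. -/
def so2Tuple (m M : ℕ) (p : (Fin m → Fin M × Fin M) × Fin M) : Fin (m + 1) → ℕ × ℤ :=
  Fin.snoc (α := fun _ => ℕ × ℤ) (fun j => (j * M + (p.1 j).1, ((p.1 j).2 : ℤ)))
    (m * M + p.2, -∑ j, ((p.1 j).2 : ℤ))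

theorem so2Tuple_injective (m M : ℕ) : Function.Injective (so2Tuple m M) := by
  rintro ⟨x, a⟩ ⟨y, b⟩ h
  have hlast := congrFun h (Fin.last m)
  simp only [so2Tuple, Fin.snoc_last, Prod.mk.injEq] at hlast
  have hcast : ∀ j, x j = y j := by
    intro j
    have hj := congrFun h j.castSucc
    simp only [so2Tuple, Fin.snoc_castSucc, Prod.mk.injEq] at hj
    exact Prod.ext (Fin.ext (by omega)) (Fin.ext (by omega))
  exact Prod.ext (funext hcast) (Fin.ext (show (a : ℕ) = b by omega))

/-- Each of the `m + 1` entries of a tuple in `so2Tuple` has degree at most `2 (m + 1) M`, so `M` may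
be taken to be `D / (2 (m + 1)^2)`. -/
theorem so2_le_ncard_basisSet (m D : ℕ) :
    (D / (2 * (m + 1) ^ 2)) ^ (2 * (m + 1) - 1) ≤ (so2.basisSet (m + 1) D).ncard := by
  set M := D / (2 * (m + 1) ^ 2) with hM
  have hMD : 2 * (m + 1) ^ 2 * M ≤ D := Nat.mul_div_le D _
  have hcard : Fintype.card ((Fin m → Fin M × Fin M) × Fin M) = M ^ (2 * (m + 1) - 1) := by
    rw [show 2 * (m + 1) - 1 = 2 * m + 1 by omega]
    simp only [Fintype.card_prod, Fintype.card_fun, Fintype.card_fin]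
    ring
  rw [← hcard]
  refine card_le_ncard_basisSet (so2Tuple m M) (so2Tuple_injective m M) (fun a => a.1 / M) ?_ ?_
    (so2_finite_deg_le D)
  · rintro ⟨x, a⟩ i
    refine Fin.lastCases ?_ (fun j => ?_) i
    · simp only [so2Tuple, Fin.snoc_last, Fin.val_last]
      exact mul_add_div_of_lt a.2
    · simp only [so2Tuple, Fin.snoc_castSucc, Fin.val_castSucc]
      exact mul_add_div_of_lt (x j).1.2
  · rintro ⟨x, a⟩
    refine ⟨⟨?_, ?_⟩, ?_, by simp⟩
    · rw [← Multiset.card_pos]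
      simp
    · rw [Multiset.map_map]
      change ∑ i, (so2Tuple m M (x, a) i).2 = 0
      rw [Fin.sum_univ_castSucc]
      simp [so2Tuple]
    · refine (totalDeg_map_univ_le (B := 2 * (m + 1) * M) _ fun i => ?_).trans
        (le_trans (le_of_eq (by ring)) hMD)
      refine Fin.lastCases ?_ (fun j => ?_) i
      · have h1 := mul_add_le_of_lt (Nat.lt_succ_self m) a.2
        have h2 := sum_fin_val_le fun j => (x j).2
        simp only [so2Tuple, Fin.snoc_last, so2]
        have h3 : (-∑ j, ((x j).2 : ℤ)).natAbs = ∑ j, ((x j).2 : ℕ) := by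
          rw [Int.natAbs_neg]
          exact_mod_cast Int.natAbs_natCast (∑ j, ((x j).2 : ℕ))
        rw [h3]
        linarith [Nat.zero_le M]
      · have h1 := mul_add_le_of_lt (j.2.trans (Nat.lt_succ_self m)) (x j).1.2
        have h2 := (x j).2.2
        simp only [so2Tuple, Fin.snoc_castSucc, so2, Int.natAbs_natCast]
        nlinarith [Nat.zero_le (m * M)]

theorem so2_auxRatio_le (ν : ℕ) (hν : 1 ≤ ν) : ∃ C : ℝ, ∀ᶠ D : ℕ in atTop,
    ∀ 𝒢 : CompGraph (ℕ × ℤ), so2.IsOutput ν D 𝒢 → so2.auxRatio ν D 𝒢 ≤ C * (1 / (D : ℝ)) := by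
  obtain ⟨m, rfl⟩ := Nat.exists_eq_add_of_le' hν
  refine ⟨((7 ^ (m + 1 - 1) * (2 * (2 * (m + 1) ^ 2)) ^ (2 * (m + 1) - 1) : ℕ) : ℝ), ?_⟩
  filter_upwards [eventually_ge_atTop (2 * (m + 1) ^ 2)] with D hD 𝒢 h
  have ht : 0 < 2 * (m + 1) ^ 2 := by positivity
  have := h.auxRatio_le hν (e := 2) (by norm_num) ht hD (so2_finite_deg_le D)
    (so2_ncard_deg_le (by omega)) (so2_le_ncard_basisSet m D)
  rwa [show 2 - 1 = 1 from rfl, pow_one] at this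

end SO2

/-! ### The group `O(3)` -/

section O3

theorem O3Index.toProd_injective :
    Function.Injective fun a : O3Index => (a.n, a.l, a.m) := by
  rintro ⟨n, l, m, h⟩ ⟨n', l', m', h'⟩ heq
  simp only [Prod.mk.injEq] at heq
  obtain ⟨rfl, rfl, rfl⟩ := heq
  rfl

theorem o3_image_deg_le_subset (D : ℕ) :
    (fun a : O3Index => (a.n, a.l, a.m)) '' {a | o3.deg a ≤ D} ⊆
      ↑(Finset.range (D + 1) ×ˢ Finset.range (D + 1) ×ˢ Finset.Icc (-(D : ℤ)) D) := by
  rintro _ ⟨⟨n, l, m, hm⟩, h, rfl⟩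
  have h' : n + l ≤ D := h
  rw [abs_le] at hm
  simp only [Finset.coe_product, Set.mem_prod, Finset.mem_coe, Finset.mem_range, Finset.mem_Icc]
  omega

theorem o3_finite_deg_le (D : ℕ) : {a | o3.deg a ≤ D}.Finite :=
  Set.Finite.of_finite_image ((Finset.finite_toSet _).subset (o3_image_deg_le_subset D))
    O3Index.toProd_injective.injOn

theorem o3_ncard_deg_le {D : ℕ} (hD : 1 ≤ D) : {a | o3.deg a ≤ D}.ncard + 1 ≤ 13 * D ^ 3 := by
  have h := Set.ncard_le_ncard (o3_image_deg_le_subset D) (Finset.finite_toSet _)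
  rw [Set.ncard_image_of_injective _ O3Index.toProd_injective, Set.ncard_coe_finset,
    Finset.card_product, Finset.card_product, Finset.card_range, Int.card_Icc,
    show ((D : ℤ) + 1 - -(D : ℤ)).toNat = 2 * D + 1 by omega] at h
  have h1 : D ≤ D ^ 2 := Nat.le_self_pow (by norm_num) D
  have h2 : D ^ 2 ≤ D ^ 3 := Nat.pow_le_pow_right hD (by norm_num)
  nlinarith

/-- Tuples of one-particle indices of `O(3)`: the radial indices lie in the blocks
`[i M, (i + 1) M)`; the last `m` makes the sum of the `m` vanish, and the last `l` leaves room for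
it and makes the sum of the `l` even. -/
def o3Tuple (m M : ℕ) (p : (Fin m → Fin M × Fin M × Fin M) × Fin M × Fin M) :
    Fin (m + 1) → O3Index :=
  Fin.snoc (α := fun _ => O3Index)
    (fun j => ⟨j * M + (p.1 j).1, M + (p.1 j).2.2, ((p.1 j).2.1 : ℕ), by
      have := (p.1 j).2.1.2
      rw [abs_le]
      omega⟩)
    ⟨m * M + p.2.1, m * M + 2 * p.2.2 + (∑ j, (M + ((p.1 j).2.2 : ℕ)) + m * M) % 2,
      -((∑ j, ((p.1 j).2.1 : ℕ) : ℕ) : ℤ), by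
      have := sum_fin_val_le fun j => (p.1 j).2.1
      rw [abs_le]
      omega⟩

theorem o3Tuple_injective (m M : ℕ) : Function.Injective (o3Tuple m M) := by
  rintro ⟨x, a, c⟩ ⟨y, b, d⟩ h
  have hcast : ∀ j, x j = y j := by
    intro j
    have hj := congrFun h j.castSucc
    simp only [o3Tuple, Fin.snoc_castSucc, O3Index.mk.injEq] at hj
    exact Prod.ext (Fin.ext (by omega)) (Prod.ext (Fin.ext (by omega)) (Fin.ext (by omega)))
  obtain rfl : x = y := funext hcast
  have hlast := congrFun h (Fin.last m)
  simp only [o3Tuple, Fin.snoc_last, O3Index.mk.injEq] at hlast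
  exact Prod.ext rfl (Prod.ext (Fin.ext (show (a : ℕ) = b by omega))
    (Fin.ext (show (c : ℕ) = d by omega)))

/-- Each of the `m + 1` entries of a tuple in `o3Tuple` has degree at most `4 (m + 1) M`, so `M` may
be taken to be `D / (4 (m + 1)^2)`. -/
theorem o3_le_ncard_basisSet (m D : ℕ) :
    (D / (4 * (m + 1) ^ 2)) ^ (3 * (m + 1) - 1) ≤ (o3.basisSet (m + 1) D).ncard := by
  set M := D / (4 * (m + 1) ^ 2) with hM
  have hMD : 4 * (m + 1) ^ 2 * M ≤ D := Nat.mul_div_le D _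
  have hcard : Fintype.card ((Fin m → Fin M × Fin M × Fin M) × Fin M × Fin M) =
      M ^ (3 * (m + 1) - 1) := by
    rw [show 3 * (m + 1) - 1 = 3 * m + 2 by omega]
    simp only [Fintype.card_prod, Fintype.card_fun, Fintype.card_fin]
    ring
  rw [← hcard]
  refine card_le_ncard_basisSet (o3Tuple m M) (o3Tuple_injective m M) (fun a => a.n / M) ?_ ?_
    (o3_finite_deg_le D)
  · rintro ⟨x, a, c⟩ i
    refine Fin.lastCases ?_ (fun j => ?_) i
    · simp only [o3Tuple, Fin.snoc_last, Fin.val_last]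
      exact mul_add_div_of_lt a.2
    · simp only [o3Tuple, Fin.snoc_castSucc, Fin.val_castSucc]
      exact mul_add_div_of_lt (x j).1.2
  · rintro ⟨x, a, c⟩
    refine ⟨⟨?_, ?_, ?_⟩, ?_, by simp⟩
    · rw [← Multiset.card_pos]
      simp
    · rw [Multiset.map_map]
      change ∑ i, (o3Tuple m M (x, a, c) i).m = 0
      rw [Fin.sum_univ_castSucc]
      simp [o3Tuple]
    · rw [Multiset.map_map]
      change Even (∑ i, (o3Tuple m M (x, a, c) i).l)
      rw [Fin.sum_univ_castSucc]
      simp only [o3Tuple, Fin.snoc_castSucc, Fin.snoc_last]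
      rw [Nat.even_iff]
      omega
    · refine (totalDeg_map_univ_le (B := 4 * (m + 1) * M) _ fun i => ?_).trans
        (le_trans (le_of_eq (by ring)) hMD)
      have hM0 : 1 ≤ M := Nat.one_le_of_lt a.2
      refine Fin.lastCases ?_ (fun j => ?_) i
      · have h1 := mul_add_le_of_lt (Nat.lt_succ_self m) a.2
        have h2 := c.2
        simp only [o3Tuple, Fin.snoc_last, o3]
        have h3 := Nat.mod_lt (∑ j, (M + ((x j).2.2 : ℕ)) + m * M) two_pos
        nlinarith [Nat.zero_le (m * M)]
      · have h1 := mul_add_le_of_lt (j.2.trans (Nat.lt_succ_self m)) (x j).1.2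
        have h2 := (x j).2.2.2
        simp only [o3Tuple, Fin.snoc_castSucc, o3]
        nlinarith [Nat.zero_le (m * M)]

theorem o3_auxRatio_le (ν : ℕ) (hν : 1 ≤ ν) : ∃ C : ℝ, ∀ᶠ D : ℕ in atTop,
    ∀ 𝒢 : CompGraph O3Index, o3.IsOutput ν D 𝒢 →
      o3.auxRatio ν D 𝒢 ≤ C * (1 / (D : ℝ) ^ 2) := by
  obtain ⟨m, rfl⟩ := Nat.exists_eq_add_of_le' hν
  refine ⟨((13 ^ (m + 1 - 1) * (2 * (4 * (m + 1) ^ 2)) ^ (3 * (m + 1) - 1) : ℕ) : ℝ), ?_⟩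
  filter_upwards [eventually_ge_atTop (4 * (m + 1) ^ 2)] with D hD 𝒢 h
  have ht : 0 < 4 * (m + 1) ^ 2 := by positivity
  exact h.auxRatio_le hν (e := 3) (by norm_num) ht hD (o3_finite_deg_le D)
    (o3_ncard_deg_le (by omega)) (o3_le_ncard_basisSet m D)

end O3

/-! ### The complexity of the heuristic -/

theorem theorem2 (ν : ℕ) (hν : 3 ≤ ν) :
    (so2.WellPosed ν ∧ o3.WellPosed ν ∧ torus.WellPosed ν) ∧
    (∃ C : ℝ, ∀ᶠ D : ℕ in atTop, ∀ 𝒢 : CompGraph (ℕ × ℤ), so2.IsOutput ν D 𝒢 →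
      so2.auxRatio ν D 𝒢 ≤ C * (1 / (D : ℝ))) ∧
    (∃ C : ℝ, ∀ᶠ D : ℕ in atTop, ∀ 𝒢 : CompGraph O3Index, o3.IsOutput ν D 𝒢 →
      o3.auxRatio ν D 𝒢 ≤ C * (1 / (D : ℝ) ^ 2)) ∧
    (∀ (D : ℕ) (𝒢 : CompGraph ℤ), torus.IsOutput ν D 𝒢 →
      (torus.auxNodes 𝒢).ncard =
        2 * ∑ k ∈ Finset.Icc 2 (ν - 1), ∑ n ∈ Finset.Icc 1 (D / 2), partitionCount k n) ∧
    (∀ 𝒢 : ℕ → CompGraph ℤ, (∀ D, torus.IsOutput ν D (𝒢 D)) →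
      Tendsto (fun D => torus.auxRatio ν D (𝒢 D)) atTop
        (𝓝 (1 / (1 + (catalan (ν - 1) : ℝ) / 2)))) ∧
    (catalan (ν - 1) : ℝ) = 1 / ((ν : ℝ) - 1) * ((2 * ν - 2).choose (ν - 2) : ℝ) := by
  refine ⟨⟨so2.wellPosed ν so2_finite_deg_le fun h => h.1 rfl,
    o3.wellPosed ν o3_finite_deg_le fun h => h.1 rfl,
    torus.wellPosed ν torus_finite_deg_le fun h => h.1 rfl⟩,
    so2_auxRatio_le ν (by omega), o3_auxRatio_le ν (by omega),
    fun D 𝒢 h => torus_ncard_auxNodes h, tendsto_torus_auxRatio ν hν, ?_⟩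
  obtain ⟨m, rfl⟩ := Nat.exists_eq_add_of_le' (show 1 ≤ ν by omega)
  have h := mul_catalan_eq_choose m (by omega)
  have hm : (m : ℝ) ≠ 0 := by
    have : m ≠ 0 := by omega
    exact_mod_cast this
  rw [show 2 * (m + 1) - 2 = 2 * m by omega, show m + 1 - 2 = m - 1 by omega, ← h]
  push_cast
  rw [add_sub_cancel_right]
  field_simp
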